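/- By a metric measure space $\mathfrak Z=(Z,\rho,\mu)$ we mean a nonempty set $Z$ with a metric $\rho$ and a Borel measure $\mu\ge 0$ such that every open ball $B(x,s)=\{y\in Z:\rho(x,y)<s\}$, $s\in(0,\infty)$, has finite and strictly positive measure. It is called nondoubling if there is no constant $C<\infty$ such that $\mu(B(x,2s))\le C\mu(B(x,s))$ for all $x\in Z$, $s>0$. For $\kappa\in[1,\infty)$ the modified centered and noncentered Hardy--Littlewood maximal operators are $$\mathcal M^{\rm c}_{\kappa}f(x)=\sup_{s>0}\frac{1}{\mu(B(x,\kappa s))}\int_{B(x,s)}|f|\,d\mu,\qquad \mathcal M_{\kappa}f(x)=\sup_{y\in Z,\ s>0:\ x\in B(y,s)}\frac{1}{\mu(B(y,\kappa s))}\int_{B(y,s)}|f|\,d\mu .$$ An operator $\mathcal H$ is of strong type $(p,p)$, $p\in[1,\infty]$, if there is $C<\infty$ with $\|\mathcal Hf\|_p\le C\|f\|_p$ for all $f\in L^p(\mathfrak Z)$; it is of weak type $(p,p)$, $p\in[1,\infty)$, if there is $C<\infty$ with $\lambda\,\mu(\{|\mathcal Hf|>\lambda\})^{1/p}\le C\|f\|_p$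 for all $f\in L^p(\mathfrak Z)$ and $\lambda\in(0,\infty)$; weak type $(\infty,\infty)$ means strong type $(\infty,\infty)$. Theorem 3.2.2. Fix $\kappa\in[1,\infty)$. Let $P^{\rm c}_{\rm s},P^{\rm c}_{\rm w},P_{\rm s},P_{\rm w}\subset[1,\infty]$ be arbitrary sets such that (i) each of them is of the form $\{\infty\}$, $[p_0,\infty]$ or $(p_0,\infty]$ for some $p_0\in[1,\infty)$ (with $p_0$ possibly different for different sets); (ii) $P_{\rm s}\subset P^{\rm c}_{\rm s}$, $P_{\rm w}\subset P^{\rm c}_{\rm w}$, $P^{\rm c}_{\rm s}\subset P^{\rm c}_{\rm w}\subset\overline{P^{\rm c}_{\rm s}}$ and $P_{\rm s}\subset P_{\rm w}\subset\overline{P_{\rm s}}$, where $\overline{E}$ is the closure of $E$ in the usual topology of $[1,\infty]$ (so that $\{\infty\}$ is closed and $\overline{(p_0,\infty]}=[p_0,\infty]$); (iii) if $\kappa\in[2,\infty)$, then $P^{\rm c}_{\rm w}=[1,\infty]$; (iv) if $\kappa\in[3,\infty)$, then $P_{\rm w}=[1,\infty]$. Then there exists a nondoubling metric measure space $\mathfrak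 Z$ such that for every $p\in[1,\infty]$: $\mathcal M^{\rm c}_{\kappa}$ is of strong type $(p,p)$ if and only if $p\in P^{\rm c}_{\rm s}$; $\mathcal M^{\rm c}_{\kappa}$ is of weak type $(p,p)$ if and only if $p\in P^{\rm c}_{\rm w}$; $\mathcal M_{\kappa}$ is of strong type $(p,p)$ if and only if $p\in P_{\rm s}$; and $\mathcal M_{\kappa}$ is of weak type $(p,p)$ if and only if $p\in P_{\rm w}$. -/

import Mathlib

open Set Metric MeasureTheory
open scoped ENNReal NNReal

/-- The modified centered Hardy--Littlewood maximal operator with parameter `κ`,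
`f ↦ (x ↦ sup_{s > 0} μ(B(x, κ s))⁻¹ ∫_{B(x,s)} |f| dμ)`, with values in `[0, ∞]`.
In `[0, ∞]` the quotient is `0` if `μ(B(x, s)) = 0` or `μ(B(x, κ s)) = ∞`, so that such balls
play no role in the supremum. For `κ ≥ 1` the function so obtained is lower semicontinuous
as soon as all balls have finite positive measure; in particular it is Borel. -/
noncomputable def modifiedCenteredMaximal {X : Type*} [MetricSpace X] [MeasurableSpace X]
    (μ : Measure X) (κ : ℝ) (f : X → ℂ) (x : X) : ℝ≥0∞ :=
  ⨆ (s : ℝ) (_ : 0 < s), (∫⁻ z in ball x s, ‖f z‖ₑ ∂μ) / μ (ball x (κ * s))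

/-- The modified noncentered Hardy--Littlewood maximal operator with parameter `κ`: the supremum is
taken over all balls `B(y, s)` (a ball being given by its center and radius) that contain `x`.
It is lower semicontinuous, hence Borel. -/
noncomputable def modifiedNoncenteredMaximal {X : Type*} [MetricSpace X] [MeasurableSpace X]
    (μ : Measure X) (κ : ℝ) (f : X → ℂ) (x : X) : ℝ≥0∞ :=
  ⨆ (y : X) (s : ℝ) (_ : 0 < s) (_ : x ∈ ball y s),
    (∫⁻ z in ball y s, ‖f z‖ₑ ∂μ) / μ (ball y (κ * s))

/-- The operator `H` is of strong type `(p, p)`: `‖H f‖_p ≤ C ‖f‖_p` uniformly in `f ∈ L^p(μ)`. -/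
def HasStrongTypePP {X : Type*} [MeasurableSpace X] (μ : Measure X)
    (H : (X → ℂ) → X → ℝ≥0∞) (p : ℝ≥0∞) : Prop :=
  ∃ C : ℝ≥0, ∀ f : X → ℂ, MemLp f p μ → eLpNorm (H f) p μ ≤ C * eLpNorm f p μ

/-- The operator `H` is of weak type `(p, p)`: for `p < ∞`,
`t * μ{x | H f x > t}^(1/p) ≤ C ‖f‖_p` uniformly in `f ∈ L^p(μ)` and `t ∈ (0, ∞)`;
weak type `(∞, ∞)` means strong type `(∞, ∞)`. -/
def HasWeakTypePP {X : Type*} [MeasurableSpace X] (μ : Measure X)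
    (H : (X → ℂ) → X → ℝ≥0∞) (p : ℝ≥0∞) : Prop :=
  (p = ∞ ∧ HasStrongTypePP μ H ∞) ∨
  (p ≠ ∞ ∧ ∃ C : ℝ≥0, ∀ f : X → ℂ, MemLp f p μ → ∀ t : ℝ≥0, 0 < t →
    (t : ℝ≥0∞) * μ {x | (t : ℝ≥0∞) < H f x} ^ (1 / p.toReal) ≤ C * eLpNorm f p μ)

/-- The measure `μ` is doubling: `μ(B(x, 2 s)) ≤ C μ(B(x, s))` for all balls, with a finite `C`. -/
def IsDoublingMetricMeasure {X : Type*} [MetricSpace X] [MeasurableSpace X]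
    (μ : Measure X) : Prop :=
  ∃ C : ℝ≥0, ∀ (x : X) (s : ℝ), 0 < s → μ (ball x (2 * s)) ≤ C * μ (ball x s)

/-- `P` is of one of the forms `{∞}`, `[p₀, ∞]`, `(p₀, ∞]` with `p₀ ∈ [1, ∞)`. -/
def IsExponentRay (P : Set ℝ≥0∞) : Prop :=
  P = {∞} ∨ ∃ p₀ : ℝ≥0∞, 1 ≤ p₀ ∧ p₀ < ∞ ∧ (P = Icc p₀ ∞ ∨ P = Ioc p₀ ∞)

/-! The space is a disjoint union of countably many finite metric blocks of diameter at most `1`,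
placed at mutual distance `1 + 2κ`. A ball either stays inside one block or is the whole space.
Rescaling the measure of a block does not change ratios inside it, so the masses can be made
summable. Averages over the whole space are then harmless by Jensen's inequality, and a type
inequality holds on the union if and only if it holds on the blocks with a uniform constant
(`exists_nondoubling_glue`). Doubling fails because the block masses tend to zero while the total
mass is fixed. The exponent `∞` is admissible for every operator.

Taking the union of two families of blocks intersects their sets of admissible exponents
(`FamilyRealizes.sum`). One family realizes `Psc`, `Pwc` for the centered and the noncentered
operator alike; the other one realizes `Ps`, `Pw` for the noncentered operator and leaves the
centered one bounded for every exponent. The inclusions `Ps ⊆ Psc` and `Pw ⊆ Pwc` make the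
intersections the required sets.

Two kinds of blocks suffice. In a star, a unit mass at the center is seen from a leaf of weight `w`
with value comparable to `1 / w`, so strong type amounts to a bound on the sum of `w ^ (1 - p)` over
the leaves, and weak type to a bound on the mass of the leaves with `w < v` by a multiple of `v ^
p`. The numbers of leaves of weight `2 ^ j` are free and produce every admissible pair of rays. If
distinct leaves are far apart, this works for the centered operator when `κ < 2`. If they are near,
only the noncentered operator sees the effect, and it does so when `κ < 3`.

For larger `κ` weak type `(1, 1)` is prescribed and only strong type `(1, 1)` can fail. Chains with
geometric positions and geometric weights do this: positions with ratio `4κ` spoil it for both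
operators, positions with ratio `κ` only for the noncentered one. -/

/-! ### Discrete measures given by weights -/

/-- The measure with mass `w x` at each point `x`. -/
noncomputable def weightedMeasure {X : Type*} [MeasurableSpace X] (w : X → ℝ≥0∞) : Measure X :=
  Measure.sum fun x => w x • Measure.dirac x

section WeightedMeasure

variable {X : Type*} [MeasurableSpace X] [DiscreteMeasurableSpace X] (w : X → ℝ≥0∞)

theorem lintegral_weightedMeasure (F : X → ℝ≥0∞) :
    ∫⁻ x, F x ∂(weightedMeasure w) = ∑' x, w x * F x := by
  simp [weightedMeasure, lintegral_sum_measure, lintegral_smul_measure, lintegral_dirac]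

theorem weightedMeasure_apply (S : Set X) :
    weightedMeasure w S = ∑' x, S.indicator w x := by
  rw [← lintegral_indicator_one (MeasurableSet.of_discrete (s := S)), lintegral_weightedMeasure]
  refine tsum_congr fun x => ?_
  by_cases hx : x ∈ S <;> simp [hx]

theorem weightedMeasure_singleton (a : X) : weightedMeasure w {a} = w a := by
  rw [weightedMeasure_apply, tsum_eq_single a]
  · simp
  · intro b hb
    simp [hb]

theorem weightedMeasure_univ : weightedMeasure w univ = ∑' x, w x := by
  simp [weightedMeasure_apply]

end WeightedMeasure

/-! ### Elementary inequalities -/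

theorem ENNReal.add_rpow_le_two_rpow (a b : ℝ≥0∞) {p : ℝ} (hp : 0 ≤ p) :
    (a + b) ^ p ≤ 2 ^ p * (a ^ p + b ^ p) := by
  have h : a + b ≤ 2 * max a b := by
    rw [two_mul]
    exact add_le_add (le_max_left _ _) (le_max_right _ _)
  calc (a + b) ^ p ≤ (2 * max a b) ^ p := ENNReal.rpow_le_rpow h hp
    _ = 2 ^ p * (max a b) ^ p := ENNReal.mul_rpow_of_nonneg _ _ hp
    _ ≤ _ := by
      gcongr
      rcases max_cases a b with h | h
      · rw [h.1]; exact le_self_add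
      · rw [h.1]; exact le_add_self

theorem lintegral_rpow_le_rpow_measure_univ_mul {X : Type*} [MeasurableSpace X] (μ : Measure X)
    (F : X → ℝ≥0∞) (hF : Measurable F) {p : ℝ} (hp : 1 ≤ p) :
    (∫⁻ x, F x ∂μ) ^ p ≤ μ univ ^ (p - 1) * ∫⁻ x, F x ^ p ∂μ := by
  have hp0 : 0 < p := by linarith
  have h := eLpNorm'_le_eLpNorm'_mul_rpow_measure_univ (μ := μ) (f := F) zero_lt_one hp
    hF.aestronglyMeasurable
  simp only [eLpNorm', enorm_eq_self, ENNReal.rpow_one, div_one] at h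
  calc (∫⁻ x, F x ∂μ) ^ p
      ≤ ((∫⁻ x, F x ^ p ∂μ) ^ (1 / p) * μ univ ^ (1 - 1 / p)) ^ p :=
        ENNReal.rpow_le_rpow h hp0.le
    _ = _ := by
      rw [ENNReal.mul_rpow_of_nonneg _ _ hp0.le, ← ENNReal.rpow_mul, ← ENNReal.rpow_mul,
        one_div_mul_cancel hp0.ne', ENNReal.rpow_one, mul_comm]
      congr 2
      field_simp

theorem rpow_mul_measure_lt_le {X : Type*} [MeasurableSpace X] (μ : Measure X)
    (F : X → ℝ≥0∞) (hF : Measurable F) {p : ℝ} (hp : 0 ≤ p) (t : ℝ≥0∞) :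
    t ^ p * μ {x | t < F x} ≤ ∫⁻ x, F x ^ p ∂μ := by
  refine le_trans ?_ (mul_meas_ge_le_lintegral (hF.pow_const p) (t ^ p))
  exact mul_le_mul_right (measure_mono fun x hx => ENNReal.rpow_le_rpow (le_of_lt hx) hp) _

/-! ### Uniform strong and weak bounds -/

/-- `H` satisfies the strong type `(p, p)` inequality with constant `C ^ (1 / p)`. -/
def StrongBound {X : Type*} [MeasurableSpace X] (μ : Measure X)
    (H : (X → ℂ) → X → ℝ≥0∞) (p : ℝ) (C : ℝ≥0) : Prop :=
  ∀ f : X → ℂ, ∫⁻ x, H f x ^ p ∂μ ≤ C * ∫⁻ x, ‖f x‖ₑ ^ p ∂μ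

/-- `H` satisfies the weak type `(p, p)` inequality with constant `C ^ (1 / p)`. -/
def WeakBound {X : Type*} [MeasurableSpace X] (μ : Measure X)
    (H : (X → ℂ) → X → ℝ≥0∞) (p : ℝ) (C : ℝ≥0) : Prop :=
  ∀ (f : X → ℂ) (t : ℝ≥0), 0 < t →
    (t : ℝ≥0∞) ^ p * μ {x | (t : ℝ≥0∞) < H f x} ≤ C * ∫⁻ x, ‖f x‖ₑ ^ p ∂μ

section Bounds

variable {X : Type*} [MeasurableSpace X] {μ : Measure X} {H H' : (X → ℂ) → X → ℝ≥0∞} {p : ℝ}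

theorem StrongBound.mono_op {C : ℝ≥0} (hp : 0 ≤ p) (hH : ∀ f x, H' f x ≤ H f x)
    (h : StrongBound μ H p C) : StrongBound μ H' p C := fun f =>
  (lintegral_mono fun x => ENNReal.rpow_le_rpow (hH f x) hp).trans (h f)

theorem WeakBound.mono_op {C : ℝ≥0} (hH : ∀ f x, H' f x ≤ H f x)
    (h : WeakBound μ H p C) : WeakBound μ H' p C := fun f t ht => by
  refine le_trans ?_ (h f t ht)
  gcongr
  exact hH f _

theorem StrongBound.weakBound [DiscreteMeasurableSpace X] {C : ℝ≥0} (hp : 0 ≤ p)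
    (h : StrongBound μ H p C) : WeakBound μ H p C := fun f t _ =>
  (rpow_mul_measure_lt_le μ _ Measurable.of_discrete hp t).trans (h f)

theorem eLpNorm_ofReal_exponent {ε : Type*} [ENorm ε] (hp : 0 < p) (f : X → ε) :
    eLpNorm f (ENNReal.ofReal p) μ = (∫⁻ x, ‖f x‖ₑ ^ p ∂μ) ^ (1 / p) := by
  rw [eLpNorm_eq_lintegral_rpow_enorm_toReal (by simpa using hp) ENNReal.ofReal_ne_top,
    ENNReal.toReal_ofReal hp.le]

theorem StrongBound.hasStrongTypePP {C : ℝ≥0} (hp : 0 < p) (h : StrongBound μ H p C) :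
    HasStrongTypePP μ H (ENNReal.ofReal p) := by
  refine ⟨C ^ (1 / p), fun f _ => ?_⟩
  rw [eLpNorm_ofReal_exponent hp, eLpNorm_ofReal_exponent hp, ENNReal.coe_rpow_of_nonneg _ (by positivity),
    ← ENNReal.mul_rpow_of_nonneg _ _ (by positivity)]
  simp only [enorm_eq_self]
  exact ENNReal.rpow_le_rpow (h f) (by positivity)

theorem HasStrongTypePP.exists_lintegral_le (hp : 0 < p)
    (h : HasStrongTypePP μ H (ENNReal.ofReal p)) :
    ∃ C : ℝ≥0, ∀ f : X → ℂ, MemLp f (ENNReal.ofReal p) μ →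
      ∫⁻ x, H f x ^ p ∂μ ≤ C * ∫⁻ x, ‖f x‖ₑ ^ p ∂μ := by
  obtain ⟨C, hC⟩ := h
  refine ⟨C ^ p, fun f hf => ?_⟩
  have := ENNReal.rpow_le_rpow (hC f hf) hp.le
  rwa [eLpNorm_ofReal_exponent hp, eLpNorm_ofReal_exponent hp, ENNReal.mul_rpow_of_nonneg _ _ hp.le,
    ← ENNReal.rpow_mul, ← ENNReal.rpow_mul, one_div_mul_cancel hp.ne', ENNReal.rpow_one,
    ENNReal.rpow_one, ← ENNReal.coe_rpow_of_nonneg _ hp.le] at this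

theorem WeakBound.hasWeakTypePP {C : ℝ≥0} (hp : 0 < p) (h : WeakBound μ H p C) :
    HasWeakTypePP μ H (ENNReal.ofReal p) := by
  refine Or.inr ⟨ENNReal.ofReal_ne_top, C ^ (1 / p), fun f _ t ht => ?_⟩
  have := ENNReal.rpow_le_rpow (h f t ht) (z := 1 / p) (by positivity)
  rw [ENNReal.mul_rpow_of_nonneg _ _ (by positivity), ENNReal.mul_rpow_of_nonneg _ _ (by positivity),
    ← ENNReal.rpow_mul, mul_one_div_cancel hp.ne', ENNReal.rpow_one,
    ← ENNReal.coe_rpow_of_nonneg _ (by positivity), ← eLpNorm_ofReal_exponent hp] at this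
  rwa [ENNReal.toReal_ofReal hp.le]

theorem HasWeakTypePP.exists_measure_le (hp : 0 < p)
    (h : HasWeakTypePP μ H (ENNReal.ofReal p)) :
    ∃ C : ℝ≥0, ∀ f : X → ℂ, MemLp f (ENNReal.ofReal p) μ → ∀ t : ℝ≥0, 0 < t →
      (t : ℝ≥0∞) ^ p * μ {x | (t : ℝ≥0∞) < H f x} ≤ C * ∫⁻ x, ‖f x‖ₑ ^ p ∂μ := by
  rcases h with h | ⟨-, C, hC⟩
  · exact absurd h.1 ENNReal.ofReal_ne_top
  refine ⟨C ^ p, fun f hf t ht => ?_⟩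
  have := ENNReal.rpow_le_rpow (hC f hf t ht) hp.le
  rwa [eLpNorm_ofReal_exponent hp, ENNReal.mul_rpow_of_nonneg _ _ hp.le, ENNReal.mul_rpow_of_nonneg _ _ hp.le,
    ← ENNReal.rpow_mul, ← ENNReal.rpow_mul, ENNReal.toReal_ofReal hp.le,
    one_div_mul_cancel hp.ne', ENNReal.rpow_one,
    ENNReal.rpow_one, ← ENNReal.coe_rpow_of_nonneg C hp.le] at this

theorem hasStrongTypePP_top {H : (X → ℂ) → X → ℝ≥0∞}
    (h : ∀ f x, H f x ≤ eLpNorm f ∞ μ) : HasStrongTypePP μ H ∞ := by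
  refine ⟨1, fun f _ => ?_⟩
  rw [ENNReal.coe_one, one_mul, eLpNorm_exponent_top]
  exact eLpNormEssSup_le_of_ae_enorm_bound (Filter.Eventually.of_forall fun x => by
    simpa using h f x)

end Bounds

/-! ### Elementary properties of the maximal operators -/

section Maximal

variable {X : Type*} [MetricSpace X] [MeasurableSpace X] {μ : Measure X} {κ : ℝ}

theorem centered_le_noncentered (f : X → ℂ) (x : X) :
    modifiedCenteredMaximal μ κ f x ≤ modifiedNoncenteredMaximal μ κ f x := by
  refine iSup₂_le fun s hs => ?_
  exact le_iSup_of_le x (le_iSup_of_le s (le_iSup_of_le hs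
    (le_iSup_of_le (mem_ball_self hs) le_rfl)))

theorem le_centered (f : X → ℂ) (x : X) {s : ℝ} (hs : 0 < s) :
    (∫⁻ z in ball x s, ‖f z‖ₑ ∂μ) / μ (ball x (κ * s)) ≤ modifiedCenteredMaximal μ κ f x :=
  le_iSup₂_of_le s hs le_rfl

theorem le_noncentered (f : X → ℂ) {x y : X} {s : ℝ} (hs : 0 < s) (hx : x ∈ ball y s) :
    (∫⁻ z in ball y s, ‖f z‖ₑ ∂μ) / μ (ball y (κ * s)) ≤ modifiedNoncenteredMaximal μ κ f x :=
  le_iSup_of_le y (le_iSup_of_le s (le_iSup_of_le hs (le_iSup_of_le hx le_rfl)))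

theorem div_measure_le (hκ : 1 ≤ κ) (x : X) {s : ℝ} (hs : 0 < s) (a : ℝ≥0∞) :
    a / μ (ball x (κ * s)) ≤ a / μ (ball x s) :=
  ENNReal.div_le_div_left (measure_mono (ball_subset_ball (by nlinarith))) _

theorem noncentered_le_eLpNorm_top (hκ : 1 ≤ κ) (f : X → ℂ) (x : X) :
    modifiedNoncenteredMaximal μ κ f x ≤ eLpNorm f ∞ μ := by
  refine iSup_le fun y => iSup_le fun s => iSup_le fun hs => iSup_le fun _ => ?_
  refine (div_measure_le hκ y hs _).trans (ENNReal.div_le_of_le_mul ?_)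
  rw [eLpNorm_exponent_top]
  calc ∫⁻ z in ball y s, ‖f z‖ₑ ∂μ ≤ ∫⁻ _ in ball y s, eLpNormEssSup f μ ∂μ :=
        lintegral_mono_ae (ae_restrict_of_ae (enorm_ae_le_eLpNormEssSup f μ))
    _ = _ := by simp

end Maximal

/-! ### Gluing finite metric blocks -/

/-- A finite metric space of diameter at most `1` with a positive weight at each point. -/
structure MetricBlock where
  carrier : Type
  [finite : Finite carrier]
  [nonempty : Nonempty carrier]
  [metricSpace : MetricSpace carrier]
  weight : carrier → ℝ≥0∞
  weight_ne_zero : ∀ x, weight x ≠ 0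
  weight_ne_top : ∀ x, weight x ≠ ∞
  dist_le_one : ∀ x y : carrier, dist x y ≤ 1

namespace MetricBlock

attribute [instance] finite nonempty metricSpace

instance (B : MetricBlock) : MeasurableSpace B.carrier := ⊤

/-- The measure of a block. -/
noncomputable def measure (B : MetricBlock) : Measure B.carrier := weightedMeasure B.weight

/-- The centered maximal operator of a block. -/
noncomputable def centered (κ : ℝ) (B : MetricBlock) : (B.carrier → ℂ) → B.carrier → ℝ≥0∞ :=
  modifiedCenteredMaximal B.measure κ

/-- The noncentered maximal operator of a block. -/
noncomputable def noncentered (κ : ℝ) (B : MetricBlock) : (B.carrier → ℂ) → B.carrier → ℝ≥0∞ :=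
  modifiedNoncenteredMaximal B.measure κ

theorem measure_univ_ne_top (B : MetricBlock) : B.measure univ ≠ ∞ := by
  have := Fintype.ofFinite B.carrier
  rw [measure, weightedMeasure_univ, tsum_fintype]
  exact ENNReal.sum_ne_top.2 fun x _ => B.weight_ne_top x

theorem measure_ne_zero (B : MetricBlock) {S : Set B.carrier} (hS : S.Nonempty) :
    B.measure S ≠ 0 := by
  obtain ⟨x, hx⟩ := hS
  intro h
  have := measure_mono_null (singleton_subset_iff.2 hx) h
  rw [measure, weightedMeasure_singleton] at this
  exact B.weight_ne_zero x this

end MetricBlock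

/-- The disjoint union of a family of blocks; points in different blocks have the distance
`1 + 2 * |κ|`. -/
def Glue (_κ : ℝ) {ι : Type} (B : ι → MetricBlock) : Type := Σ i, (B i).carrier

namespace Glue

variable {κ : ℝ} {ι : Type} {B : ι → MetricBlock}

/-- The inclusion of a block. -/
def incl (i : ι) (x : (B i).carrier) : Glue κ B := ⟨i, x⟩

theorem incl_injective (i : ι) : Function.Injective (incl (κ := κ) (B := B) i) :=
  fun _ _ h => eq_of_heq (Sigma.mk.inj h).2

theorem incl_ne {i j : ι} (h : i ≠ j) (x : (B i).carrier) (y : (B j).carrier) :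
    incl (κ := κ) i x ≠ incl j y := fun h' => h (congrArg Sigma.fst h')

open Classical in
noncomputable instance : Dist (Glue κ B) where
  dist a b := if h : a.1 = b.1 then dist (h ▸ a.2 : (B b.1).carrier) b.2 else 1 + 2 * |κ|

theorem dist_incl (i : ι) (x y : (B i).carrier) :
    dist (incl (κ := κ) i x) (incl i y) = dist x y := by
  exact dif_pos rfl

theorem dist_incl_ne {i j : ι} (h : i ≠ j) (x : (B i).carrier) (y : (B j).carrier) :
    dist (incl (κ := κ) i x) (incl j y) = 1 + 2 * |κ| := by
  simp [dist, incl, h]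

/-- The only delicate triangle has its middle vertex in a foreign block; it is settled by the
diameter bound `1`. The absolute value in `1 + 2 * |κ|` frees the instance from any sign condition
on `κ`. -/
noncomputable instance : MetricSpace (Glue κ B) where
  dist_self := by
    rintro ⟨i, x⟩
    exact (dist_incl i x x).trans (dist_self x)
  dist_comm := by
    rintro ⟨i, x⟩ ⟨j, y⟩
    by_cases h : i = j
    · subst h
      exact (dist_incl i x y).trans ((dist_comm x y).trans (dist_incl i y x).symm)
    · exact (dist_incl_ne h x y).trans (dist_incl_ne (Ne.symm h) y x).symm
  dist_triangle := by
    rintro ⟨i, x⟩ ⟨j, y⟩ ⟨k, z⟩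
    change dist (incl i x) (incl k z) ≤ dist (incl i x) (incl j y) + dist (incl j y) (incl k z)
    have hκ := abs_nonneg κ
    by_cases hij : i = j
    · subst hij
      by_cases hik : i = k
      · subst hik
        simpa [dist_incl] using dist_triangle x y z
      · rw [dist_incl, dist_incl_ne hik, dist_incl_ne hik]
        linarith [dist_nonneg (x := x) (y := y)]
    · by_cases hik : i = k
      · subst hik
        rw [dist_incl, dist_incl_ne hij, dist_incl_ne (Ne.symm hij)]
        linarith [(B i).dist_le_one x z]
      · rw [dist_incl_ne hij, dist_incl_ne hik]
        by_cases hjk : j = k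
        · subst hjk
          rw [dist_incl]
          linarith [dist_nonneg (x := y) (y := z)]
        · rw [dist_incl_ne hjk]
          linarith
  eq_of_dist_eq_zero := by
    rintro ⟨i, x⟩ ⟨j, y⟩ h
    change dist (incl i x) (incl j y) = 0 at h
    by_cases hij : i = j
    · subst hij
      rw [dist_incl] at h
      rw [eq_of_dist_eq_zero h]
    · rw [dist_incl_ne hij] at h
      linarith [abs_nonneg κ]

instance : MeasurableSpace (Glue κ B) := ⊤

/-- Since balls are open, the radius equal to the distance between blocks is still allowed;
`not_isDoubling` uses this borderline radius. -/
theorem ball_of_le (i : ι) (x : (B i).carrier) {s : ℝ} (hs : s ≤ 1 + 2 * |κ|) :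
    ball (incl (κ := κ) i x) s = incl i '' ball x s := by
  ext ⟨j, y⟩
  change incl j y ∈ _ ↔ incl j y ∈ _
  by_cases h : j = i
  · subst h
    rw [(incl_injective j).mem_set_image, mem_ball, mem_ball, dist_incl]
  · rw [mem_ball, dist_incl_ne h]
    constructor
    · intro h'
      linarith
    · rintro ⟨z, -, hz⟩
      exact absurd hz (incl_ne (Ne.symm h) _ _)

theorem ball_of_lt (a : Glue κ B) {s : ℝ} (hs : 1 + 2 * |κ| < s) : ball a s = univ := by
  refine eq_univ_of_forall fun b => ?_
  obtain ⟨i, x⟩ := a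
  obtain ⟨j, y⟩ := b
  change dist (incl j y) (incl i x) < s
  by_cases h : j = i
  · subst h
    rw [dist_incl]
    linarith [(B j).dist_le_one y x, abs_nonneg κ]
  · rwa [dist_incl_ne h]

instance : DiscreteTopology (Glue κ B) := by
  refine discreteTopology_iff_isOpen_singleton.2 ?_
  rintro ⟨i, x⟩
  obtain ⟨ε, hε, h⟩ := Metric.isOpen_singleton_iff.1 (isOpen_discrete ({x} : Set (B i).carrier))
  refine Metric.isOpen_singleton_iff.2 ⟨min ε 1, by positivity, ?_⟩
  rintro ⟨j, y⟩ hy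
  change dist (incl j y) (incl i x) < _ at hy
  by_cases hji : j = i
  · subst hji
    rw [dist_incl] at hy
    rw [h y (hy.trans_le (min_le_left _ _))]
  · rw [dist_incl_ne hji] at hy
    linarith [abs_nonneg κ, min_le_right ε 1]

instance : BorelSpace (Glue κ B) := ⟨borel_eq_top_of_discrete.symm⟩

/-- The measure on the union for which the `i`-th block carries `c i` times its own measure. -/
noncomputable def measure (κ : ℝ) (B : ι → MetricBlock) (c : ι → ℝ≥0∞) : Measure (Glue κ B) :=
  weightedMeasure fun a => c a.1 * (B a.1).weight a.2

variable {c : ι → ℝ≥0∞}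

theorem lintegral_measure (F : Glue κ B → ℝ≥0∞) :
    ∫⁻ a, F a ∂(measure κ B c) = ∑' i, c i * ∫⁻ x, F (incl i x) ∂(B i).measure := by
  simp only [measure, MetricBlock.measure, lintegral_weightedMeasure]
  refine (ENNReal.tsum_sigma' _).trans (tsum_congr fun i => ?_)
  rw [← ENNReal.tsum_mul_left]
  exact tsum_congr fun x => mul_assoc _ _ _

theorem setLIntegral_image_incl (i : ι) (S : Set (B i).carrier) (F : Glue κ B → ℝ≥0∞) :
    ∫⁻ a in incl i '' S, F a ∂(measure κ B c)
      = c i * ∫⁻ x in S, F (incl i x) ∂(B i).measure := by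
  rw [← lintegral_indicator MeasurableSet.of_discrete,
    ← lintegral_indicator MeasurableSet.of_discrete, lintegral_measure, tsum_eq_single i]
  · congr 1
    refine lintegral_congr fun x => ?_
    by_cases hx : x ∈ S
    · rw [indicator_of_mem hx, indicator_of_mem (mem_image_of_mem _ hx)]
    · rw [indicator_of_notMem hx, indicator_of_notMem]
      rwa [(incl_injective i).mem_set_image]
  · intro j hj
    have : ∀ x : (B j).carrier, (incl (κ := κ) i '' S).indicator F (incl j x) = 0 := by
      intro x
      refine indicator_of_notMem ?_ _
      rintro ⟨y, -, hy⟩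
      exact incl_ne (Ne.symm hj) _ _ hy
    simp [this]

theorem measure_image_incl (i : ι) (S : Set (B i).carrier) :
    measure κ B c (incl i '' S) = c i * (B i).measure S := by
  simpa using setLIntegral_image_incl (κ := κ) (c := c) i S (fun _ => 1)

theorem measure_apply (S : Set (Glue κ B)) :
    measure κ B c S = ∑' i, c i * (B i).measure (incl i ⁻¹' S) := by
  rw [← lintegral_indicator_one MeasurableSet.of_discrete, lintegral_measure]
  refine tsum_congr fun i => ?_
  rw [← lintegral_indicator_one MeasurableSet.of_discrete]
  rfl

theorem measure_ne_zero (hc : ∀ i, c i ≠ 0) {S : Set (Glue κ B)} (hS : S.Nonempty) :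
    measure κ B c S ≠ 0 := by
  obtain ⟨⟨i, x⟩, hx⟩ := hS
  intro h
  have := measure_mono_null (s := incl i '' {x}) (by rw [image_singleton]; exact singleton_subset_iff.2 hx) h
  rw [measure_image_incl, mul_eq_zero, or_iff_right (hc i)] at this
  exact (B i).measure_ne_zero (singleton_nonempty x) this

section Maximal

variable (hκ : 1 ≤ κ) (hc : ∀ i, c i ≠ 0) (hc' : ∀ i, c i ≠ ∞)

include hc hc' in
theorem ball_ratio (f : Glue κ B → ℂ) (i : ι) (x : (B i).carrier) {s t : ℝ}
    (hs : s ≤ 1 + 2 * |κ|) (ht : t ≤ 1 + 2 * |κ|) :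
    (∫⁻ a in ball (incl i x) s, ‖f a‖ₑ ∂(measure κ B c)) / measure κ B c (ball (incl i x) t)
      = (∫⁻ y in ball x s, ‖f (incl i y)‖ₑ ∂(B i).measure) / (B i).measure (ball x t) := by
  rw [ball_of_le i x hs, ball_of_le i x ht, setLIntegral_image_incl, measure_image_incl,
    ENNReal.mul_div_mul_left _ _ (hc i) (hc' i)]

include hκ hc hc' in
theorem ratio_le_glue (f : Glue κ B → ℂ) (i : ι) (x y : (B i).carrier) {s : ℝ} (hs : 0 < s)
    (hx : x ∈ ball y s) :
    ∃ s', 0 < s' ∧ incl (κ := κ) i x ∈ ball (incl (κ := κ) i y) s' ∧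
    (∫⁻ z in ball y s, ‖f (incl i z)‖ₑ ∂(B i).measure) / (B i).measure (ball y (κ * s))
      ≤ (∫⁻ a in ball (incl i y) s', ‖f a‖ₑ ∂(measure κ B c)) /
        measure κ B c (ball (incl i y) (κ * s')) := by
  have hκ' : |κ| = κ := abs_of_pos (by linarith)
  -- A ball of radius `2` already contains its block, and `κ * 2 ≤ 1 + 2κ` keeps the dilated ball
  -- inside the block.
  refine ⟨min s 2, by positivity, ?_, ?_⟩
  · rw [mem_ball, dist_incl]
    exact lt_min hx (by linarith [(B i).dist_le_one x y])
  · rw [ball_ratio hc hc' _ _ _ (by rw [hκ']; linarith [min_le_right s 2])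
      (by rw [hκ']; nlinarith [min_le_right s 2])]
    refine ENNReal.div_le_div (lintegral_mono_set fun z hz => ?_)
      (measure_mono (ball_subset_ball (by nlinarith [min_le_left s 2])))
    exact mem_ball.2 (lt_min hz (by linarith [(B i).dist_le_one z y]))

include hκ hc hc' in
-- For `s ≤ 1 + 2κ` the inner ball lies in the block; the dilated ball may leave it, which only
-- increases the denominator. For larger `s` both balls are the whole space.
theorem glue_ratio_le (f : Glue κ B → ℂ) (i : ι) (x : (B i).carrier) (a : Glue κ B) {s : ℝ}
    (ha : incl i x ∈ ball a s) :
    (∃ y, a = incl i y ∧ x ∈ ball y s ∧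
      (∫⁻ a in ball (incl i y) s, ‖f a‖ₑ ∂(measure κ B c)) /
        measure κ B c (ball (incl i y) (κ * s)) ≤
      (∫⁻ z in ball y s, ‖f (incl i z)‖ₑ ∂(B i).measure) / (B i).measure (ball y (κ * s))) ∨
    (∫⁻ b in ball a s, ‖f b‖ₑ ∂(measure κ B c)) / measure κ B c (ball a (κ * s)) ≤
      (∫⁻ b, ‖f b‖ₑ ∂(measure κ B c)) / measure κ B c univ := by
  have hs : 0 < s := pos_of_mem_ball ha
  rcases le_or_gt s (1 + 2 * |κ|) with h | h
  · left
    obtain ⟨j, y⟩ := a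
    change incl i x ∈ ball (incl j y) s at ha
    obtain rfl : i = j := by
      by_contra hij
      rw [mem_ball, dist_incl_ne hij] at ha
      linarith
    refine ⟨y, rfl, by rwa [mem_ball, dist_incl] at ha, ?_⟩
    rw [← ENNReal.mul_div_mul_left (a := ∫⁻ z in ball y s, _ ∂_) _ (hc i) (hc' i),
      ← setLIntegral_image_incl (κ := κ) i (ball y s) (fun a => ‖f a‖ₑ), ← ball_of_le i y h,
      ← measure_image_incl (κ := κ)]
    refine ENNReal.div_le_div_left (measure_mono ?_) _
    rintro _ ⟨z, hz, rfl⟩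
    rwa [mem_ball, dist_incl]
  · right
    rw [ball_of_lt a h, ball_of_lt a (s := κ * s) (by nlinarith [abs_nonneg κ]),
      setLIntegral_univ]

include hκ hc hc' in
theorem centered_le_glue (f : Glue κ B → ℂ) (i : ι) (x : (B i).carrier) :
    (B i).centered κ (f ∘ incl i) x
      ≤ modifiedCenteredMaximal (measure κ B c) κ f (incl i x) := by
  refine iSup₂_le fun s hs => ?_
  obtain ⟨s', hs', -, h⟩ := ratio_le_glue hκ hc hc' f i x x hs (mem_ball_self hs)
  exact h.trans (le_centered f _ hs')

include hκ hc hc' in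
theorem noncentered_le_glue (f : Glue κ B → ℂ) (i : ι) (x : (B i).carrier) :
    (B i).noncentered κ (f ∘ incl i) x
      ≤ modifiedNoncenteredMaximal (measure κ B c) κ f (incl i x) := by
  refine iSup_le fun y => iSup_le fun s => iSup_le fun hs => iSup_le fun hx => ?_
  obtain ⟨s', hs', hx', h⟩ := ratio_le_glue hκ hc hc' f i x y hs hx
  exact h.trans (le_noncentered f hs' hx')

include hκ hc hc' in
theorem glue_le_centered (f : Glue κ B → ℂ) (i : ι) (x : (B i).carrier) :
    modifiedCenteredMaximal (measure κ B c) κ f (incl i x) ≤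
      max ((B i).centered κ (f ∘ incl i) x)
        ((∫⁻ b, ‖f b‖ₑ ∂(measure κ B c)) / measure κ B c univ) := by
  refine iSup₂_le fun s hs => ?_
  rcases glue_ratio_le hκ hc hc' f i x _ (mem_ball_self hs) with ⟨y, hy, -, h⟩ | h
  · obtain rfl := incl_injective i hy
    exact le_max_of_le_left (h.trans (le_centered (f ∘ incl i) _ hs))
  · exact le_max_of_le_right h

include hκ hc hc' in
theorem glue_le_noncentered (f : Glue κ B → ℂ) (i : ι) (x : (B i).carrier) :
    modifiedNoncenteredMaximal (measure κ B c) κ f (incl i x) ≤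
      max ((B i).noncentered κ (f ∘ incl i) x)
        ((∫⁻ b, ‖f b‖ₑ ∂(measure κ B c)) / measure κ B c univ) := by
  refine iSup_le fun a => iSup_le fun s => iSup_le fun hs => iSup_le fun hx => ?_
  rcases glue_ratio_le hκ hc hc' f i x a hx with ⟨y, rfl, hy, h⟩ | h
  · exact le_max_of_le_left (h.trans (le_noncentered (f ∘ incl i) hs hy))
  · exact le_max_of_le_right h

end Maximal

end Glue

/-! ### Transference of type inequalities between the blocks and the glued space -/

theorem rpow_lintegral_div_mul_le {X : Type*} [MeasurableSpace X] [DiscreteMeasurableSpace X]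
    (μ : Measure X) (h0 : μ univ ≠ 0) (hT : μ univ ≠ ∞) (F : X → ℝ≥0∞) {p : ℝ} (hp : 1 ≤ p) :
    ((∫⁻ x, F x ∂μ) / μ univ) ^ p * μ univ ≤ ∫⁻ x, F x ^ p ∂μ := by
  have hp0 : 0 ≤ p := by linarith
  rw [ENNReal.div_rpow_of_nonneg _ _ hp0]
  refine (mul_le_mul_left (ENNReal.div_le_div_right
    (lintegral_rpow_le_rpow_measure_univ_mul μ F Measurable.of_discrete hp) _) _).trans ?_
  rw [ENNReal.rpow_sub _ _ h0 hT, ENNReal.rpow_one]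
  have h1 : μ univ ^ p ≠ 0 := (ENNReal.rpow_pos (pos_iff_ne_zero.2 h0) hT).ne'
  have h2 : μ univ ^ p ≠ ∞ := ENNReal.rpow_ne_top_of_nonneg hp0 hT
  refine le_of_eq ?_
  calc _ = (∫⁻ x, F x ^ p ∂μ) * (μ univ ^ p * (μ univ ^ p)⁻¹) * (μ univ * (μ univ)⁻¹) := by
        simp only [div_eq_mul_inv]; ring
    _ = _ := by
        rw [ENNReal.mul_inv_cancel h1 h2, ENNReal.mul_inv_cancel h0 hT, mul_one, mul_one]

namespace Glue

variable {κ : ℝ} {ι : Type} {B : ι → MetricBlock} {c : ι → ℝ≥0∞}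

theorem lintegral_extend (i : ι) (f : (B i).carrier → ℂ) {p : ℝ} (hp : 0 < p) :
    ∫⁻ a, ‖Function.extend (incl (κ := κ) i) f 0 a‖ₑ ^ p ∂(measure κ B c)
      = c i * ∫⁻ x, ‖f x‖ₑ ^ p ∂(B i).measure := by
  rw [lintegral_measure, tsum_eq_single i]
  · simp_rw [(incl_injective i).extend_apply]
  · intro j hj
    have : ∀ x : (B j).carrier, Function.extend (incl (κ := κ) i) f 0 (incl j x) = 0 := by
      intro x
      rw [Function.extend_apply', Pi.zero_apply]
      rintro ⟨y, hy⟩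
      exact incl_ne (Ne.symm hj) _ _ hy
    simp [this, hp]

theorem memLp_extend [Countable ι] (hc' : ∀ i, c i ≠ ∞) (i : ι) (f : (B i).carrier → ℂ) {p : ℝ}
    (hp : 0 < p) :
    MemLp (Function.extend (incl (κ := κ) i) f 0) (ENNReal.ofReal p) (measure κ B c) := by
  refine ⟨Measurable.of_discrete.aestronglyMeasurable, ?_⟩
  rw [eLpNorm_ofReal_exponent hp, lintegral_extend i f hp]
  refine ENNReal.rpow_lt_top_of_nonneg (by positivity) (ENNReal.mul_ne_top (hc' i) ?_)
  have := Fintype.ofFinite (B i).carrier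
  rw [MetricBlock.measure, lintegral_weightedMeasure, tsum_fintype]
  refine ENNReal.sum_ne_top.2 fun x _ => ENNReal.mul_ne_top ((B i).weight_ne_top x) ?_
  exact ENNReal.rpow_ne_top_of_nonneg hp.le enorm_ne_top

section Transference

variable [Countable ι] (hc : ∀ i, c i ≠ 0) (hc' : ∀ i, c i ≠ ∞)
  (hT : measure κ B c univ ≠ ∞) (h0 : measure κ B c univ ≠ 0)
  {H : ∀ i, ((B i).carrier → ℂ) → (B i).carrier → ℝ≥0∞}
  {HZ : (Glue κ B → ℂ) → Glue κ B → ℝ≥0∞}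
  (hlower : ∀ f i x, H i (f ∘ incl i) x ≤ HZ f (incl i x))
  (hupper : ∀ f i x, HZ f (incl i x) ≤ max (H i (f ∘ incl i) x)
    ((∫⁻ b, ‖f b‖ₑ ∂(measure κ B c)) / measure κ B c univ))

include hc hc' hT h0 hlower hupper

/-- Testing on functions extended by zero from one block gives the uniform bound; the factor `c i`
cancels. Conversely the block inequalities are summed. -/
theorem hasStrongTypePP_iff {p : ℝ} (hp : 1 ≤ p) :
    HasStrongTypePP (measure κ B c) HZ (ENNReal.ofReal p) ↔
      ∃ C : ℝ≥0, ∀ i, StrongBound (B i).measure (H i) p C := by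
  have hp0 : 0 < p := by linarith
  constructor
  · intro h
    obtain ⟨C, hC⟩ := h.exists_lintegral_le hp0
    refine ⟨C, fun i f => ?_⟩
    have := hC _ (memLp_extend hc' i f hp0)
    rw [lintegral_extend i f hp0, mul_left_comm] at this
    refine (ENNReal.mul_le_mul_iff_right (hc i) (hc' i)).1 (le_trans ?_ this)
    rw [lintegral_measure]
    refine le_trans ?_ (ENNReal.le_tsum i)
    refine mul_le_mul_right (lintegral_mono fun x => ENNReal.rpow_le_rpow ?_ hp0.le) _
    refine le_trans (le_of_eq ?_) (hlower _ i x)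
    rw [Function.extend_comp (incl_injective i)]
  · rintro ⟨C, hC⟩
    -- The additional `1` pays for the global average `A`.
    refine StrongBound.hasStrongTypePP hp0 (C := C + 1) fun f => ?_
    set A := (∫⁻ b, ‖f b‖ₑ ∂(measure κ B c)) / measure κ B c univ with hA
    calc ∫⁻ a, HZ f a ^ p ∂(measure κ B c)
        = ∑' i, c i * ∫⁻ x, HZ f (incl i x) ^ p ∂(B i).measure := lintegral_measure _
      _ ≤ ∑' i, (C * (c i * ∫⁻ x, ‖f (incl i x)‖ₑ ^ p ∂(B i).measure)
            + A ^ p * (c i * (B i).measure univ)) := by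
          refine ENNReal.tsum_le_tsum fun i => ?_
          rw [mul_left_comm, mul_left_comm (A ^ p), ← mul_add]
          refine mul_le_mul_right ?_ _
          calc ∫⁻ x, HZ f (incl i x) ^ p ∂(B i).measure
              ≤ ∫⁻ x, (H i (f ∘ incl i) x ^ p + A ^ p) ∂(B i).measure := by
                refine lintegral_mono fun x => ?_
                refine (ENNReal.rpow_le_rpow (hupper f i x) hp0.le).trans ?_
                rcases max_cases (H i (f ∘ incl i) x) A with h | h
                · rw [h.1]; exact le_self_add
                · rw [h.1]; exact le_add_self
            _ = ∫⁻ x, H i (f ∘ incl i) x ^ p ∂(B i).measure + A ^ p * (B i).measure univ := by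
                rw [lintegral_add_right _ measurable_const, lintegral_const]
            _ ≤ _ := add_le_add_left (hC i (f ∘ incl i)) _
      _ = C * ∫⁻ a, ‖f a‖ₑ ^ p ∂(measure κ B c) + A ^ p * measure κ B c univ := by
          rw [ENNReal.tsum_add, ENNReal.tsum_mul_left, ENNReal.tsum_mul_left, lintegral_measure,
            measure_apply univ]
          simp
      _ ≤ C * ∫⁻ a, ‖f a‖ₑ ^ p ∂(measure κ B c) + 1 * ∫⁻ a, ‖f a‖ₑ ^ p ∂(measure κ B c) := by
          rw [one_mul]
          exact add_le_add_right (rpow_lintegral_div_mul_le _ h0 hT _ hp) _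
      _ = _ := by rw [← add_mul]; push_cast; rfl

theorem hasWeakTypePP_iff {p : ℝ} (hp : 1 ≤ p) :
    HasWeakTypePP (measure κ B c) HZ (ENNReal.ofReal p) ↔
      ∃ C : ℝ≥0, ∀ i, WeakBound (B i).measure (H i) p C := by
  have hp0 : 0 < p := by linarith
  constructor
  · intro h
    obtain ⟨C, hC⟩ := h.exists_measure_le hp0
    refine ⟨C, fun i f t ht => ?_⟩
    have := hC _ (memLp_extend hc' i f hp0) t ht
    rw [lintegral_extend i f hp0, mul_left_comm] at this
    refine (ENNReal.mul_le_mul_iff_right (hc i) (hc' i)).1 (le_trans ?_ this)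
    rw [mul_left_comm, measure_apply]
    refine mul_le_mul_right (le_trans ?_ (ENNReal.le_tsum i)) _
    refine mul_le_mul_right (measure_mono ?_) _
    intro x hx
    refine mem_preimage.2 (lt_of_lt_of_le (mem_ofPred.1 hx) ?_)
    refine le_trans (le_of_eq ?_) (hlower _ i x)
    rw [Function.extend_comp (incl_injective i)]
  · rintro ⟨C, hC⟩
    refine WeakBound.hasWeakTypePP hp0 (C := C + 1) fun f t ht => ?_
    set A := (∫⁻ b, ‖f b‖ₑ ∂(measure κ B c)) / measure κ B c univ with hA
    rw [ENNReal.coe_add, add_mul, ENNReal.coe_one, one_mul]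
    -- If the global average exceeds `t`, Jensen's inequality bounds even the whole mass; otherwise
    -- a value above `t` must come from the operator of the block.
    by_cases hAt : (t : ℝ≥0∞) < A
    · refine le_add_of_nonneg_of_le (zero_le) ?_
      refine le_trans ?_ (rpow_lintegral_div_mul_le (measure κ B c) h0 hT _ hp)
      exact mul_le_mul' (ENNReal.rpow_le_rpow hAt.le hp0.le) (measure_mono (subset_univ _))
    · refine le_add_of_le_of_nonneg ?_ (zero_le)
      rw [measure_apply, lintegral_measure, ← ENNReal.tsum_mul_left, ← ENNReal.tsum_mul_left]
      refine ENNReal.tsum_le_tsum fun i => ?_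
      rw [mul_left_comm, mul_left_comm (C : ℝ≥0∞)]
      refine mul_le_mul_right (le_trans (mul_le_mul_right (measure_mono ?_) _)
        (hC i (f ∘ incl i) t ht)) _
      intro x hx
      exact (lt_max_iff.1 (lt_of_lt_of_le hx (hupper f i x))).resolve_right hAt

end Transference

/-- The ball of radius `1 + 2κ` is one block and its double is everything. Doubling would bound the
total mass by a multiple of block masses that tend to zero. -/
theorem not_isDoubling [Infinite ι] (hc : ∀ i, c i ≠ 0)
    (hT : measure κ B c univ ≠ ∞) : ¬ IsDoublingMetricMeasure (measure κ B c) := by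
  rintro ⟨C, hC⟩
  have hpos : 0 < 1 + 2 * |κ| := by positivity
  have h0 : measure κ B c univ ≠ 0 := measure_ne_zero hc
    ⟨incl (Classical.arbitrary ι) (Classical.arbitrary _), mem_univ _⟩
  have hle : ∀ i, measure κ B c univ ≤ C * (c i * (B i).measure univ) := by
    intro i
    have h := hC (incl i (Classical.arbitrary _)) (1 + 2 * |κ|) hpos
    rw [ball_of_lt _ (by linarith), ball_of_le _ _ le_rfl, measure_image_incl] at h
    exact h.trans (mul_le_mul_right (mul_le_mul_right (measure_mono (subset_univ _)) _) _)
  have hsum : ∑' i, c i * (B i).measure univ ≠ ∞ := by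
    rw [measure_apply] at hT
    simpa using hT
  have hlim := ENNReal.Tendsto.const_mul (ENNReal.tendsto_cofinite_zero_of_tsum_ne_top hsum)
    (Or.inr (ENNReal.coe_ne_top (r := C)))
  rw [mul_zero] at hlim
  exact h0 (le_zero_iff.1 (ge_of_tendsto' hlim hle))

end Glue

/-- A countable family of finite blocks can be glued to a nondoubling space on which the strong and
weak type inequalities of the maximal operators are the uniform ones of the blocks. -/
theorem exists_nondoubling_glue {κ : ℝ} (hκ : 1 ≤ κ) {ι : Type} [Countable ι] [Infinite ι]
    (B : ι → MetricBlock) :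
    ∃ (Z : Type) (_ : Nonempty Z) (_ : MetricSpace Z) (_ : MeasurableSpace Z) (_ : BorelSpace Z)
      (μ : Measure Z),
      (∀ (x : Z) (s : ℝ), 0 < s → 0 < μ (ball x s) ∧ μ (ball x s) < ∞) ∧
      ¬ IsDoublingMetricMeasure μ ∧
      (HasStrongTypePP μ (modifiedCenteredMaximal μ κ) ∞ ∧
        HasWeakTypePP μ (modifiedCenteredMaximal μ κ) ∞ ∧
        HasStrongTypePP μ (modifiedNoncenteredMaximal μ κ) ∞ ∧
        HasWeakTypePP μ (modifiedNoncenteredMaximal μ κ) ∞) ∧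
      ∀ p : ℝ, 1 ≤ p →
        (HasStrongTypePP μ (modifiedCenteredMaximal μ κ) (ENNReal.ofReal p) ↔
          ∃ C : ℝ≥0, ∀ i, StrongBound (B i).measure ((B i).centered κ) p C) ∧
        (HasWeakTypePP μ (modifiedCenteredMaximal μ κ) (ENNReal.ofReal p) ↔
          ∃ C : ℝ≥0, ∀ i, WeakBound (B i).measure ((B i).centered κ) p C) ∧
        (HasStrongTypePP μ (modifiedNoncenteredMaximal μ κ) (ENNReal.ofReal p) ↔
          ∃ C : ℝ≥0, ∀ i, StrongBound (B i).measure ((B i).noncentered κ) p C) ∧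
        (HasWeakTypePP μ (modifiedNoncenteredMaximal μ κ) (ENNReal.ofReal p) ↔
          ∃ C : ℝ≥0, ∀ i, WeakBound (B i).measure ((B i).noncentered κ) p C) := by
  obtain ⟨ε, hε, hsum⟩ := ENNReal.exists_pos_sum_of_countable' one_ne_zero ι
  have hB0 : ∀ i, (B i).measure univ ≠ 0 := fun i => (B i).measure_ne_zero univ_nonempty
  -- With this factor the block `i` has mass `ε i`, and the total mass is less than `1`.
  set c : ι → ℝ≥0∞ := fun i => ε i / (B i).measure univ with hcdef
  have hε' : ∀ i, ε i ≠ ∞ := fun i =>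
    ne_top_of_le_ne_top ENNReal.one_ne_top ((ENNReal.le_tsum i).trans hsum.le)
  have hc : ∀ i, c i ≠ 0 := fun i =>
    ENNReal.div_ne_zero.2 ⟨(hε i).ne', (B i).measure_univ_ne_top⟩
  have hc' : ∀ i, c i ≠ ∞ := fun i => ENNReal.div_ne_top (hε' i) (hB0 i)
  have hT : Glue.measure κ B c univ ≠ ∞ := by
    rw [Glue.measure_apply]
    refine ne_top_of_le_ne_top ENNReal.one_ne_top (le_trans (le_of_eq ?_) hsum.le)
    refine tsum_congr fun i => ?_
    rw [preimage_univ]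
    exact ENNReal.div_mul_cancel (hB0 i) (B i).measure_univ_ne_top
  have hne : Nonempty (Glue κ B) :=
    ⟨Glue.incl (Classical.arbitrary ι) (Classical.arbitrary _)⟩
  have h0 : Glue.measure κ B c univ ≠ 0 := Glue.measure_ne_zero hc univ_nonempty
  have hs : HasStrongTypePP (Glue.measure κ B c)
      (modifiedNoncenteredMaximal (Glue.measure κ B c) κ) ∞ :=
    hasStrongTypePP_top fun f x => noncentered_le_eLpNorm_top hκ f x
  have hs' : HasStrongTypePP (Glue.measure κ B c)
      (modifiedCenteredMaximal (Glue.measure κ B c) κ) ∞ :=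
    hasStrongTypePP_top fun f x =>
      (centered_le_noncentered f x).trans (noncentered_le_eLpNorm_top hκ f x)
  refine ⟨Glue κ B, hne, inferInstance, inferInstance, inferInstance, Glue.measure κ B c,
    fun x s hs => ⟨pos_iff_ne_zero.2 (Glue.measure_ne_zero hc ⟨x, mem_ball_self hs⟩),
      (measure_mono (subset_univ _)).trans_lt hT.lt_top⟩, Glue.not_isDoubling hc hT,
    ⟨hs', Or.inl ⟨rfl, hs'⟩, hs, Or.inl ⟨rfl, hs⟩⟩, fun p hp => ⟨?_, ?_, ?_, ?_⟩⟩
  · exact Glue.hasStrongTypePP_iff hc hc' hT h0 (Glue.centered_le_glue hκ hc hc')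
      (Glue.glue_le_centered hκ hc hc') hp
  · exact Glue.hasWeakTypePP_iff hc hc' hT h0 (Glue.centered_le_glue hκ hc hc')
      (Glue.glue_le_centered hκ hc hc') hp
  · exact Glue.hasStrongTypePP_iff hc hc' hT h0 (Glue.noncentered_le_glue hκ hc hc')
      (Glue.glue_le_noncentered hκ hc hc') hp
  · exact Glue.hasWeakTypePP_iff hc hc' hT h0 (Glue.noncentered_le_glue hκ hc hc')
      (Glue.glue_le_noncentered hκ hc hc') hp

/-! ### Star blocks -/

/-- The points of a star: a center, and over each `l : L` a leaf and a point in the middle between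
the leaf and the center. The parameter `far` decides about the distance between leaves. -/
inductive StarPt (far : Bool) (L : Type) : Type
  | center : StarPt far L
  | mid (l : L) : StarPt far L
  | leaf (l : L) : StarPt far L

namespace StarPt

variable {far : Bool} {L : Type}

/-- The points of a star as a sum type. -/
def equivSum : StarPt far L ≃ Option L ⊕ L where
  toFun
    | center => Sum.inl none
    | mid l => Sum.inl (some l)
    | leaf l => Sum.inr l
  invFun
    | Sum.inl none => center
    | Sum.inl (some l) => mid l
    | Sum.inr l => leaf l
  left_inv := by rintro (_ | _ | _) <;> rfl
  right_inv := by rintro ((_ | _) | _) <;> rfl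

noncomputable instance [Fintype L] : Fintype (StarPt far L) := Fintype.ofEquiv _ equivSum.symm

instance : Nonempty (StarPt far L) := ⟨center⟩

theorem sum_eq [Fintype L] (F : StarPt far L → ℝ≥0∞) :
    ∑ x, F x = F center + ∑ l, F (mid l) + ∑ l, F (leaf l) := by
  rw [← equivSum.symm.sum_comp, Fintype.sum_sum_type, Fintype.sum_option]
  rfl

open Classical in
/-- The distance function of a star. -/
noncomputable def starDist : StarPt far L → StarPt far L → ℝ
  | center, center => 0
  | center, mid _ => 1 / 4
  | mid _, center => 1 / 4
  | center, leaf _ => 1 / 2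
  | leaf _, center => 1 / 2
  | mid i, mid j => if i = j then 0 else 1 / 2
  | mid i, leaf j => if i = j then 1 / 4 else 3 / 4
  | leaf i, mid j => if i = j then 1 / 4 else 3 / 4
  | leaf i, leaf j => if i = j then 0 else if far then 1 else 1 / 2

noncomputable instance : MetricSpace (StarPt far L) where
  dist := starDist
  dist_self := by
    rintro (_ | _ | _) <;> simp [starDist]
  dist_comm := by
    rintro (_ | i | i) (_ | j | j) <;> simp only [starDist] <;> (try split_ifs) <;>
      first | rfl | (exfalso; grind)
  dist_triangle := by
    rintro (_ | i | i) (_ | j | j) (_ | k | k) <;> simp only [starDist] <;> (try split_ifs) <;>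
      first | (norm_num; done) | (exfalso; grind)
  eq_of_dist_eq_zero := by
    rintro (_ | i | i) (_ | j | j) <;> simp only [starDist] <;> (try split_ifs) <;> intro h <;>
      first | (norm_num at h; done) | simp_all

theorem dist_eq (x y : StarPt far L) : dist x y = starDist x y := rfl

theorem dist_le_one (x y : StarPt far L) : dist x y ≤ 1 := by
  rcases x with _ | i | i <;> rcases y with _ | j | j <;> simp only [dist_eq, starDist] <;>
    (try split_ifs) <;> norm_num

instance : MeasurableSpace (StarPt far L) := ⊤

/-- From any point all leaves, except at most one closer leaf, are equally far away. -/
theorem ball_leaf_all {z : StarPt far L} {s : ℝ} {i j : L} (hij : i ≠ j)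
    (hi : leaf i ∈ ball z s) (hj : leaf j ∈ ball z s) (l : L) : leaf l ∈ ball z s := by
  rw [mem_ball] at *
  rcases z with _ | k | k <;> simp only [dist_eq, starDist] at * <;> (try split_ifs at *) <;>
    first | linarith | (exfalso; grind)

/-- Such a ball is centered at a middle point and has radius at most `1 / 4`, whereas two middle
points have distance `1 / 2`. -/
theorem ball_eq_of_center_notMem {z u : StarPt far L} {s : ℝ} (hc : center ∉ ball z s)
    (hl : ∀ l, leaf l ∉ ball z s) (hu : u ∈ ball z s) : ball z s = {u} := by
  have hz : z ∈ ball z s := mem_ball_self (pos_of_mem_ball hu)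
  have key : ∀ v ∈ ball z s, v = z := by
    intro v hv
    rw [mem_ball] at *
    rcases z with _ | k | k
    · exact absurd hz hc
    · rcases v with _ | i | i
      · exact absurd hv hc
      · simp only [dist_eq, starDist] at hc hv
        split_ifs at hv with h
        · rw [h]
        · linarith
      · exact absurd hv (hl i)
    · exact absurd hz (hl k)
  rw [key u hu]
  exact Subset.antisymm (fun v hv => key v hv) (singleton_subset_iff.2 hz)

/-- When leaves are near, the center is at distance `1 / 2` from a leaf, exactly as the other leaves
are: no ball around a leaf reaches the center without swallowing all leaves. -/
theorem ball_leaf_of_near (l : L) (s : ℝ) :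
    (∀ i, leaf (far := false) i ∈ ball (leaf l) s) ∨
      ball (leaf (far := false) l) s ⊆ {leaf l, mid l} := by
  by_cases hs : 1 / 2 < s
  · left
    intro i
    rw [mem_ball]
    simp only [dist_eq, starDist]
    split_ifs <;> first | linarith | contradiction
  · right
    rintro (_ | i | i) hi <;> rw [mem_ball] at hi <;> simp only [dist_eq, starDist] at hi <;>
      (try split_ifs at hi) <;> first | (exfalso; linarith) | simp_all

theorem center_mem_ball_leaf (l : L) {s : ℝ} (hs : 1 / 2 < s) :
    (center : StarPt far L) ∈ ball (leaf l) s := by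
  rw [mem_ball]
  exact hs

theorem leaf_notMem_ball_leaf {i l : L} (h : i ≠ l) : leaf (far := true) i ∉ ball (leaf l) 1 := by
  rw [mem_ball]
  simp [dist_eq, starDist, h]

theorem center_mem_ball_mid (l : L) {s : ℝ} (hs : 1 / 4 < s) :
    (center : StarPt far L) ∈ ball (mid l) s := by
  rw [mem_ball]
  exact hs

theorem leaf_mem_ball_mid (l : L) {s : ℝ} (hs : 1 / 4 < s) :
    (leaf l : StarPt far L) ∈ ball (mid l) s := by
  rw [mem_ball]
  simpa [dist_eq, starDist] using hs

theorem leaf_notMem_ball_mid {i l : L} (h : i ≠ l) :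
    (leaf i : StarPt far L) ∉ ball (mid l) (3 / 4) := by
  rw [mem_ball]
  simp [dist_eq, starDist, h]

/-- The part of a star that consists of the points which are not leaves. -/
def core (far : Bool) (L : Type) : Set (StarPt far L) := (range leaf)ᶜ

theorem center_mem_core : (center : StarPt far L) ∈ core far L := by simp [core]

theorem mid_mem_core (l : L) : (mid l : StarPt far L) ∈ core far L := by simp [core]

theorem leaf_notMem_core (l : L) : (leaf l : StarPt far L) ∉ core far L := by simp [core]

/-! ### Masses and integrals on a star -/

section Measure

variable [Fintype L]

/-- The weights of a star with given weights of the leaves. -/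
noncomputable def weight (far : Bool) (w : L → ℝ≥0∞) : StarPt far L → ℝ≥0∞
  | center => 1
  | mid _ => (Fintype.card L : ℝ≥0∞)⁻¹
  | leaf l => w l

/-- The measure on a star with given weights of the leaves. -/
noncomputable def starMeasure (far : Bool) (w : L → ℝ≥0∞) : Measure (StarPt far L) :=
  weightedMeasure (weight far w)

variable {w : L → ℝ≥0∞}

theorem lintegral_star (F : StarPt far L → ℝ≥0∞) :
    ∫⁻ x, F x ∂(starMeasure far w) = F center +
      ∑ l, (Fintype.card L : ℝ≥0∞)⁻¹ * F (mid l) + ∑ l, w l * F (leaf l) := by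
  rw [starMeasure, lintegral_weightedMeasure, tsum_fintype, sum_eq]
  simp [weight]

theorem setLIntegral_star (S : Set (StarPt far L)) (F : StarPt far L → ℝ≥0∞) :
    ∫⁻ x in S, F x ∂(starMeasure far w) = S.indicator F center +
      ∑ l, (Fintype.card L : ℝ≥0∞)⁻¹ * S.indicator F (mid l)
        + ∑ l, w l * S.indicator F (leaf l) := by
  rw [← lintegral_indicator MeasurableSet.of_discrete, lintegral_star]

theorem measure_core_le : starMeasure far w (core far L) ≤ 2 := by
  rw [← setLIntegral_one, setLIntegral_star]
  simp only [center_mem_core, mid_mem_core, leaf_notMem_core, indicator_of_mem,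
    indicator_of_notMem, not_false_eq_true, mul_zero, Finset.sum_const_zero, add_zero, mul_one,
    Finset.sum_const, Finset.card_univ, nsmul_eq_mul]
  rw [← one_add_one_eq_two]
  gcongr
  exact ENNReal.mul_inv_le_one _

theorem le_measure_of_leaf_mem {S : Set (StarPt far L)} {l : L} (hl : leaf l ∈ S) :
    w l ≤ starMeasure far w S := by
  refine le_trans (le_of_eq ?_) (measure_mono (singleton_subset_iff.2 hl))
  rw [starMeasure, weightedMeasure_singleton, weight]

theorem le_measure_of_center_mem {S : Set (StarPt far L)} (hl : center ∈ S) :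
    1 ≤ starMeasure far w S := by
  refine le_trans (le_of_eq ?_) (measure_mono (singleton_subset_iff.2 hl))
  rw [starMeasure, weightedMeasure_singleton, weight]

theorem setLIntegral_le_of_unique_leaf {S : Set (StarPt far L)} (F : StarPt far L → ℝ≥0∞) {l : L}
    (hl : ∀ i, leaf i ∈ S → i = l) :
    ∫⁻ x in S, F x ∂(starMeasure far w) ≤
      ∫⁻ x in core far L, F x ∂(starMeasure far w) + w l * F (leaf l) := by
  have hsub : S ⊆ core far L ∪ {leaf l} := by
    rintro (_ | i | i) hi
    · exact Or.inl center_mem_core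
    · exact Or.inl (mid_mem_core i)
    · exact Or.inr (by rw [hl i hi]; rfl)
  refine (lintegral_mono_set hsub).trans ((lintegral_union_le _ _ _).trans ?_)
  rw [lintegral_singleton, starMeasure, weightedMeasure_singleton, weight, mul_comm (w l)]

/-- The non-leaves have mass at most `2`, which is at most twice the weight of a single leaf. -/
theorem measure_univ_le (hw : ∀ l, 1 ≤ w l) [Nonempty L] {S : Set (StarPt far L)}
    (hS : ∀ l, leaf l ∈ S) : starMeasure far w univ ≤ 3 * starMeasure far w S := by
  have hS1 : 1 ≤ starMeasure far w S :=
    (hw (Classical.arbitrary L)).trans (le_measure_of_leaf_mem (hS _))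
  calc starMeasure far w univ ≤ starMeasure far w (core far L ∪ S) := by
        refine measure_mono ?_
        rintro (_ | i | i) -
        · exact Or.inl center_mem_core
        · exact Or.inl (mid_mem_core i)
        · exact Or.inr (hS i)
    _ ≤ starMeasure far w (core far L) + starMeasure far w S := measure_union_le _ _
    _ ≤ 2 * starMeasure far w S + starMeasure far w S := by
        gcongr
        exact measure_core_le.trans (le_mul_of_one_le_right (by positivity) hS1)
    _ = 3 * starMeasure far w S := by ring

end Measure

end StarPt

/-! ### From pointwise domination to integral inequalities -/

section PointwiseDomination

variable {X : Type*} [MeasurableSpace X] [DiscreteMeasurableSpace X] {μ : Measure X}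

theorem lintegral_add_average_rpow_le (h0 : μ univ ≠ 0) (hT : μ univ ≠ ∞) (F : X → ℝ≥0∞) {p : ℝ}
    (hp : 1 ≤ p) :
    ∫⁻ x, (F x + 3 * ((∫⁻ y, F y ∂μ) / μ univ)) ^ p ∂μ ≤
      2 ^ p * (1 + 3 ^ p) * ∫⁻ x, F x ^ p ∂μ := by
  have hp0 : 0 ≤ p := by linarith
  calc _ ≤ ∫⁻ x, 2 ^ p * (F x ^ p + 3 ^ p * ((∫⁻ y, F y ∂μ) / μ univ) ^ p) ∂μ := by
        refine lintegral_mono fun x => (ENNReal.add_rpow_le_two_rpow _ _ hp0).trans (le_of_eq ?_)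
        rw [ENNReal.mul_rpow_of_nonneg _ _ hp0]
    _ = 2 ^ p * (∫⁻ x, F x ^ p ∂μ + 3 ^ p * (((∫⁻ y, F y ∂μ) / μ univ) ^ p * μ univ)) := by
        rw [lintegral_const_mul _ Measurable.of_discrete, lintegral_add_right _ measurable_const,
          lintegral_const, mul_assoc]
    _ ≤ 2 ^ p * (∫⁻ x, F x ^ p ∂μ + 3 ^ p * ∫⁻ x, F x ^ p ∂μ) := by
        gcongr
        exact rpow_lintegral_div_mul_le μ h0 hT F hp
    _ = _ := by ring

theorem lintegral_rpow_le_of_le_add (h0 : μ univ ≠ 0) (hT : μ univ ≠ ∞) {F T G : X → ℝ≥0∞}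
    {p : ℝ} (hp : 1 ≤ p)
    (h : ∀ x, T x ≤ F x + 3 * ((∫⁻ y, F y ∂μ) / μ univ) + G x) :
    ∫⁻ x, T x ^ p ∂μ ≤
      2 ^ p * (2 ^ p * (1 + 3 ^ p) * ∫⁻ x, F x ^ p ∂μ + ∫⁻ x, G x ^ p ∂μ) := by
  have hp0 : 0 ≤ p := by linarith
  calc _ ≤ ∫⁻ x, 2 ^ p * ((F x + 3 * ((∫⁻ y, F y ∂μ) / μ univ)) ^ p + G x ^ p) ∂μ :=
        lintegral_mono fun x => (ENNReal.rpow_le_rpow (h x) hp0).trans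
          (ENNReal.add_rpow_le_two_rpow _ _ hp0)
    _ = 2 ^ p * (∫⁻ x, (F x + 3 * ((∫⁻ y, F y ∂μ) / μ univ)) ^ p ∂μ + ∫⁻ x, G x ^ p ∂μ) := by
        rw [lintegral_const_mul _ Measurable.of_discrete,
          lintegral_add_right _ Measurable.of_discrete]
    _ ≤ _ := by
        gcongr
        exact lintegral_add_average_rpow_le h0 hT F hp

/-- Only `G` has to be controlled in the weak sense: a value of `T` above `2 * τ` forces one of the
two summands above `τ`, and the summand with `F` and its average obeys a strong bound. -/
theorem rpow_mul_measure_le_of_le_add (h0 : μ univ ≠ 0) (hT : μ univ ≠ ∞) {F T G : X → ℝ≥0∞}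
    {p : ℝ} (hp : 1 ≤ p)
    (h : ∀ x, T x ≤ F x + 3 * ((∫⁻ y, F y ∂μ) / μ univ) + G x) (τ : ℝ≥0∞) :
    (2 * τ) ^ p * μ {x | 2 * τ < T x} ≤
      2 ^ p * (2 ^ p * (1 + 3 ^ p) * ∫⁻ x, F x ^ p ∂μ + τ ^ p * μ {x | τ < G x}) := by
  have hp0 : 0 ≤ p := by linarith
  have hsub : {x | 2 * τ < T x} ⊆
      {x | τ < F x + 3 * ((∫⁻ y, F y ∂μ) / μ univ)} ∪ {x | τ < G x} := by
    intro x hx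
    by_contra hcon
    simp only [mem_union, mem_ofPred_eq, not_or, not_lt] at hcon
    refine absurd (lt_of_lt_of_le hx (h x)) (not_lt.2 ?_)
    rw [two_mul]
    exact add_le_add hcon.1 hcon.2
  rw [ENNReal.mul_rpow_of_nonneg _ _ hp0, mul_assoc]
  refine mul_le_mul_right ?_ _
  calc τ ^ p * μ {x | 2 * τ < T x}
      ≤ τ ^ p * (μ {x | τ < F x + 3 * ((∫⁻ y, F y ∂μ) / μ univ)} + μ {x | τ < G x}) :=
        mul_le_mul_right ((measure_mono hsub).trans (measure_union_le _ _)) _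
    _ ≤ _ := by
        rw [mul_add]
        refine add_le_add ?_ le_rfl
        exact (rpow_mul_measure_lt_le μ _ Measurable.of_discrete hp0 τ).trans
          (lintegral_add_average_rpow_le h0 hT F hp)

end PointwiseDomination

namespace StarPt

variable {far : Bool} {L : Type} [Fintype L] {w : L → ℝ≥0∞}

theorem measure_star_univ_ne_zero : starMeasure far w univ ≠ 0 := by
  intro h
  have := le_measure_of_center_mem (w := w) (mem_univ (center : StarPt far L))
  rw [h] at this
  exact absurd this (by simp)

theorem weight_ne_top (hw : ∀ l, w l ≠ ∞) (x : StarPt far L) : weight far w x ≠ ∞ := by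
  rcases x with _ | l | l
  · exact ENNReal.one_ne_top
  · exact ENNReal.inv_ne_top.2 (Nat.cast_ne_zero.2 (Fintype.card_pos_iff.2 ⟨l⟩).ne')
  · exact hw l

theorem weight_ne_zero (hw : ∀ l, 1 ≤ w l) (x : StarPt far L) : weight far w x ≠ 0 := by
  rcases x with _ | l | l
  · exact one_ne_zero
  · exact ENNReal.inv_ne_zero.2 (ENNReal.natCast_ne_top _)
  · exact (zero_lt_one.trans_le (hw l)).ne'

theorem measure_star_univ_ne_top (hw : ∀ l, w l ≠ ∞) : starMeasure far w univ ≠ ∞ := by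
  rw [starMeasure, weightedMeasure_univ, tsum_fintype]
  exact ENNReal.sum_ne_top.2 fun x _ => weight_ne_top hw x

/-! ### Pointwise domination of the maximal functions on a star -/

section Domination

variable (F : StarPt far L → ℝ≥0∞)

/-- The `L^p` norm of a nonnegative function on a star. -/
noncomputable def starNorm (w : L → ℝ≥0∞) (p : ℝ) : ℝ≥0∞ :=
  (∫⁻ x, F x ^ p ∂(starMeasure far w)) ^ p⁻¹

theorem starNorm_rpow {p : ℝ} (hp : 1 ≤ p) :
    starNorm F w p ^ p = ∫⁻ x, F x ^ p ∂(starMeasure far w) := by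
  rw [starNorm, ← ENNReal.rpow_mul, inv_mul_cancel₀ (by linarith), ENNReal.rpow_one]

/-- Hölder's inequality on a set of mass at most `2`. -/
theorem setLIntegral_core_le {p : ℝ} (hp : 1 ≤ p) :
    ∫⁻ x in core far L, F x ∂(starMeasure far w) ≤ 2 * starNorm F w p := by
  have hp0 : 0 < p := by linarith
  rw [← ENNReal.rpow_le_rpow_iff hp0, ENNReal.mul_rpow_of_nonneg _ _ hp0.le, starNorm_rpow F hp]
  refine (lintegral_rpow_le_rpow_measure_univ_mul _ F Measurable.of_discrete hp).trans ?_
  rw [Measure.restrict_apply_univ]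
  refine mul_le_mul' ?_ (setLIntegral_le_lintegral _ _)
  calc starMeasure far w (core far L) ^ (p - 1) ≤ 2 ^ (p - 1) :=
        ENNReal.rpow_le_rpow measure_core_le (by linarith)
    _ ≤ 2 ^ p := ENNReal.rpow_le_rpow_of_exponent_le (by norm_num) (by linarith)

theorem leaf_le_starNorm (hw : ∀ l, 1 ≤ w l) {p : ℝ} (hp : 1 ≤ p) (l : L) :
    F (leaf l) ≤ starNorm F w p := by
  have hp0 : 0 < p := by linarith
  rw [← ENNReal.rpow_le_rpow_iff hp0, starNorm_rpow F hp, lintegral_star]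
  refine le_trans ?_ le_add_self
  refine le_trans (le_mul_of_one_le_left (by positivity) (hw l)) ?_
  exact Finset.single_le_sum (f := fun l => w l * F (leaf l) ^ p) (fun _ _ => by positivity)
    (Finset.mem_univ l)

/-- The function dominating the nonlocal part of the maximal functions on a star. -/
noncomputable def tail (g : L → ℝ≥0∞) (N : ℝ≥0∞) : StarPt far L → ℝ≥0∞
  | leaf l => g l
  | _ => 3 * N

theorem ratio_le_of_leaves_mem (hw : ∀ l, 1 ≤ w l) (hw' : ∀ l, w l ≠ ∞) [Nonempty L]
    {S : Set (StarPt far L)} (hS : ∀ l, leaf l ∈ S) :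
    (∫⁻ x in S, F x ∂(starMeasure far w)) / starMeasure far w S ≤
      3 * ((∫⁻ x, F x ∂(starMeasure far w)) / starMeasure far w univ) := by
  refine ENNReal.div_le_of_le_mul ((setLIntegral_le_lintegral _ _).trans ?_)
  calc ∫⁻ x, F x ∂(starMeasure far w)
      = (∫⁻ x, F x ∂(starMeasure far w)) / starMeasure far w univ * starMeasure far w univ :=
        (ENNReal.div_mul_cancel measure_star_univ_ne_zero (measure_star_univ_ne_top hw')).symm
    _ ≤ (∫⁻ x, F x ∂(starMeasure far w)) / starMeasure far w univ * (3 * starMeasure far w S) :=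
        mul_le_mul_right (measure_univ_le hw hS) _
    _ = _ := by ring

/-- A ball falls under one of four cases. With two leaves it contains all of them and its average is
controlled by the global one. With exactly one leaf `l` the average is at most `2 * N / w l + F
(leaf l)`. With the center but no leaf it is at most `2 * N`. Otherwise the ball is a single point.
Since weights of leaves are at least `1`, a point that is not a leaf gets at most `2 * N + N`,
whence the `3 * N` in `tail`. -/
theorem ratio_le (hw : ∀ l, 1 ≤ w l) (hw' : ∀ l, w l ≠ ∞) {p : ℝ} (hp : 1 ≤ p)
    {z u : StarPt far L} {s : ℝ} (hu : u ∈ ball z s) :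
    (∫⁻ x in ball z s, F x ∂(starMeasure far w)) / starMeasure far w (ball z s) ≤
      F u + 3 * ((∫⁻ x, F x ∂(starMeasure far w)) / starMeasure far w univ)
        + tail (fun l => 2 * starNorm F w p / w l) (starNorm F w p) u := by
  set N := starNorm F w p with hN
  have hcore : ∫⁻ x in core far L, F x ∂(starMeasure far w) ≤ 2 * N := setLIntegral_core_le F hp
  by_cases hleaf : ∃ l, leaf l ∈ ball z s
  · obtain ⟨l, hl⟩ := hleaf
    have : Nonempty L := ⟨l⟩
    by_cases huniq : ∀ i, leaf i ∈ ball z s → i = l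
    · have hw0 : w l ≠ 0 := (zero_lt_one.trans_le (hw l)).ne'
      have hmain : (∫⁻ x in ball z s, F x ∂(starMeasure far w)) / starMeasure far w (ball z s) ≤
          2 * N / w l + F (leaf l) := by
        calc _ ≤ (2 * N + w l * F (leaf l)) / w l :=
              ENNReal.div_le_div ((setLIntegral_le_of_unique_leaf F huniq).trans
                (add_le_add_left hcore _)) (le_measure_of_leaf_mem hl)
          _ = _ := by
              rw [ENNReal.add_div, mul_comm (w l), ENNReal.mul_div_cancel_right hw0 (hw' l)]
      have hcase : (∃ i, u = leaf i) ∨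
          tail (fun l => 2 * N / w l) N u = 3 * N := by
        rcases u with _ | i | i
        exacts [Or.inr rfl, Or.inr rfl, Or.inl ⟨i, rfl⟩]
      rcases hcase with ⟨i, rfl⟩ | hcase
      · obtain rfl := huniq i hu
        refine hmain.trans ?_
        rw [add_comm]
        exact add_le_add le_self_add le_rfl
      · rw [hcase]
        refine hmain.trans (le_trans ?_ le_add_self)
        calc 2 * N / w l + F (leaf l) ≤ 2 * N + N := by
              refine add_le_add (ENNReal.div_le_of_le_mul ?_) (leaf_le_starNorm F hw hp l)
              exact le_mul_of_one_le_right (by positivity) (hw l)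
          _ = 3 * N := by ring
    · push Not at huniq
      obtain ⟨i, hi, hil⟩ := huniq
      refine (ratio_le_of_leaves_mem F hw hw' (ball_leaf_all hil hi hl)).trans ?_
      exact le_add_self.trans le_self_add
  · push Not at hleaf
    by_cases hc : center ∈ ball z s
    · have htail : tail (fun l => 2 * N / w l) N u = 3 * N := by
        rcases u with _ | i | i
        exacts [rfl, rfl, absurd hu (hleaf i)]
      rw [htail]
      refine le_trans ?_ le_add_self
      have hsub : ball z s ⊆ core far L := by
        rintro x hx ⟨l, rfl⟩
        exact hleaf l hx
      calc _ ≤ 2 * N / 1 := ENNReal.div_le_div ((lintegral_mono_set hsub).trans hcore)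
            (le_measure_of_center_mem hc)
        _ ≤ 3 * N := by
            rw [div_one]
            gcongr
            norm_num
    · rw [ball_eq_of_center_notMem hc hleaf hu, lintegral_singleton]
      refine (ENNReal.div_le_of_le_mul le_rfl).trans ?_
      rw [add_assoc]
      exact le_self_add

theorem noncentered_le (hw : ∀ l, 1 ≤ w l) (hw' : ∀ l, w l ≠ ∞) {p : ℝ} (hp : 1 ≤ p)
    {κ : ℝ} (hκ : 1 ≤ κ) (f : StarPt far L → ℂ) (u : StarPt far L) :
    modifiedNoncenteredMaximal (starMeasure far w) κ f u ≤
      ‖f u‖ₑ + 3 * ((∫⁻ x, ‖f x‖ₑ ∂(starMeasure far w)) / starMeasure far w univ)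
        + tail (fun l => 2 * starNorm (fun x => ‖f x‖ₑ) w p / w l)
          (starNorm (fun x => ‖f x‖ₑ) w p) u := by
  refine iSup_le fun y => iSup_le fun s => iSup_le fun hs => iSup_le fun hu => ?_
  exact (div_measure_le hκ y hs _).trans (ratio_le _ hw hw' hp hu)

/-- By `ball_leaf_of_near` a leaf sees, apart from itself and the global average, only its own
middle point. The dangerous term `N / w l` is thereby replaced by one that can be summed for every
exponent. -/
theorem centered_le_of_near {w : L → ℝ≥0∞} (hw : ∀ l, 1 ≤ w l) (hw' : ∀ l, w l ≠ ∞) {p : ℝ}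
    (hp : 1 ≤ p) {κ : ℝ} (hκ : 1 ≤ κ) (f : StarPt false L → ℂ) (u : StarPt false L) :
    modifiedCenteredMaximal (starMeasure false w) κ f u ≤
      ‖f u‖ₑ + 3 * ((∫⁻ x, ‖f x‖ₑ ∂(starMeasure false w)) / starMeasure false w univ)
        + tail (fun l => ‖f (mid l)‖ₑ * (Fintype.card L : ℝ≥0∞)⁻¹ / w l)
          (starNorm (fun x => ‖f x‖ₑ) w p) u := by
  have hcase : (∃ i, u = leaf i) ∨
      tail (fun l => ‖f (mid l)‖ₑ * (Fintype.card L : ℝ≥0∞)⁻¹ / w l)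
          (starNorm (fun x => ‖f x‖ₑ) w p) u
        = tail (fun l => 2 * starNorm (fun x => ‖f x‖ₑ) w p / w l)
          (starNorm (fun x => ‖f x‖ₑ) w p) u := by
    rcases u with _ | i | i
    exacts [Or.inr rfl, Or.inr rfl, Or.inl ⟨i, rfl⟩]
  rcases hcase with ⟨l, rfl⟩ | hcase
  · refine iSup₂_le fun s hs => (div_measure_le hκ _ hs _).trans ?_
    have : Nonempty L := ⟨l⟩
    rcases ball_leaf_of_near l s with h | h
    · refine (ratio_le_of_leaves_mem _ hw hw' h).trans ?_
      exact le_add_self.trans le_self_add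
    · have hw0 : w l ≠ 0 := (zero_lt_one.trans_le (hw l)).ne'
      calc _ ≤ (‖f (leaf l)‖ₑ * w l + ‖f (mid l)‖ₑ * (Fintype.card L : ℝ≥0∞)⁻¹) / w l := by
            refine ENNReal.div_le_div ?_ (le_measure_of_leaf_mem (mem_ball_self hs))
            refine (lintegral_mono_set h).trans ?_
            rw [← singleton_union]
            refine (lintegral_union_le _ _ _).trans (le_of_eq ?_)
            rw [lintegral_singleton, lintegral_singleton, starMeasure, weightedMeasure_singleton,
              weightedMeasure_singleton, weight, weight]
        _ = ‖f (leaf l)‖ₑ + ‖f (mid l)‖ₑ * (Fintype.card L : ℝ≥0∞)⁻¹ / w l := by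
            rw [ENNReal.add_div, ENNReal.mul_div_cancel_right hw0 (hw' l)]
        _ ≤ _ := add_le_add le_self_add le_rfl
  · rw [hcase]
    exact (centered_le_noncentered f u).trans (noncentered_le hw hw' hp hκ f u)

theorem lintegral_tail_rpow (g : L → ℝ≥0∞) (N : ℝ≥0∞) {p : ℝ} (hp : 1 ≤ p) :
    ∫⁻ x, tail g N x ^ p ∂(starMeasure far w) ≤ 2 * 3 ^ p * N ^ p + ∑ l, w l * g l ^ p := by
  rw [lintegral_star]
  refine add_le_add ?_ le_rfl
  simp only [tail, Finset.sum_const, Finset.card_univ, nsmul_eq_mul]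
  rw [ENNReal.mul_rpow_of_nonneg _ _ (by linarith : 0 ≤ p), ← mul_assoc, mul_assoc 2, two_mul]
  refine add_le_add le_rfl ?_
  exact (mul_le_mul_left (ENNReal.mul_inv_le_one _) _).trans (one_mul _).le

theorem rpow_mul_measure_lt_tail_le (g : L → ℝ≥0∞) (N : ℝ≥0∞) {p : ℝ} (hp : 1 ≤ p) (τ : ℝ≥0∞) :
    τ ^ p * starMeasure far w {x | τ < tail g N x} ≤
      2 * 3 ^ p * N ^ p + τ ^ p * ∑ l, {l | τ < g l}.indicator w l := by
  have hp0 : 0 ≤ p := by linarith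
  have h1 : {x : StarPt far L | τ < tail g N x} ⊆
      {x | x ∈ core far L ∧ τ < 3 * N} ∪ leaf '' {l | τ < g l} := by
    rintro (_ | i | i) hi
    · exact Or.inl ⟨center_mem_core, hi⟩
    · exact Or.inl ⟨mid_mem_core i, hi⟩
    · exact Or.inr ⟨i, hi, rfl⟩
  have h2 : starMeasure far w (leaf '' {l | τ < g l}) = ∑ l, {l | τ < g l}.indicator w l := by
    rw [starMeasure, weightedMeasure_apply, tsum_fintype, sum_eq]
    have hc : (center : StarPt far L) ∉ leaf '' {l | τ < g l} := by simp
    have hm : ∀ i, (mid i : StarPt far L) ∉ leaf '' {l | τ < g l} := by simp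
    simp only [indicator_of_notMem hc, indicator_of_notMem (hm _), Finset.sum_const_zero, zero_add]
    refine Finset.sum_congr rfl fun l _ => ?_
    by_cases hl : τ < g l
    · have hl' : l ∈ {l | τ < g l} := hl
      rw [indicator_of_mem (mem_image_of_mem _ hl'), indicator_of_mem hl', weight]
    · rw [indicator_of_notMem, indicator_of_notMem (by exact hl)]
      rintro ⟨i, hi, h⟩
      injection h with h
      exact hl (h ▸ hi)
  have h3 : τ ^ p * starMeasure far w {x | x ∈ core far L ∧ τ < 3 * N} ≤
      2 * 3 ^ p * N ^ p := by
    by_cases h : τ < 3 * N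
    · rw [mul_assoc, ← ENNReal.mul_rpow_of_nonneg _ _ hp0, mul_comm (2 : ℝ≥0∞)]
      refine mul_le_mul' (ENNReal.rpow_le_rpow h.le hp0) (le_trans (measure_mono ?_) measure_core_le)
      exact fun x hx => hx.1
    · simp [h]
  calc _ ≤ τ ^ p * (starMeasure far w {x | x ∈ core far L ∧ τ < 3 * N} +
        starMeasure far w (leaf '' {l | τ < g l})) :=
        mul_le_mul_right ((measure_mono h1).trans (measure_union_le _ _)) _
    _ ≤ _ := by
        rw [mul_add, h2]
        exact add_le_add h3 le_rfl

end Domination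

end StarPt

/-- A constant for the maximal inequalities on stars. -/
noncomputable def starConst (p : ℝ) (D : ℝ≥0) : ℝ≥0 :=
  2 ^ p * (2 ^ p * (1 + 3 ^ p) + (2 * 3 ^ p + 2 ^ p * D))

theorem starConst_mul {p : ℝ} (hp : 0 ≤ p) (D : ℝ≥0) (I : ℝ≥0∞) :
    (starConst p D : ℝ≥0∞) * I =
      2 ^ p * (2 ^ p * (1 + 3 ^ p) * I + (2 * 3 ^ p * I + 2 ^ p * D * I)) := by
  simp only [starConst, ENNReal.coe_mul, ENNReal.coe_add, ENNReal.coe_rpow_of_nonneg _ hp,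
    ENNReal.coe_one, ENNReal.coe_ofNat]
  ring

namespace StarPt

/-! ### Upper bounds for the operators on stars -/

section Upper

variable {far : Bool} {L : Type} [Fintype L] {w : L → ℝ≥0∞}
  (hw : ∀ l, 1 ≤ w l) (hw' : ∀ l, w l ≠ ∞) {p κ : ℝ} (hp : 1 ≤ p) (hκ : 1 ≤ κ) {D : ℝ≥0}

include hw hw' hp hκ

theorem noncentered_strongBound (hD : ∑ l, w l * (w l)⁻¹ ^ p ≤ D) :
    StrongBound (starMeasure far w) (modifiedNoncenteredMaximal (starMeasure far w) κ) p
      (starConst p D) := by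
  intro f
  have hp0 : 0 ≤ p := by linarith
  set I := ∫⁻ x, ‖f x‖ₑ ^ p ∂(starMeasure far w) with hI
  set N := starNorm (fun x => ‖f x‖ₑ) w p with hN
  have hNI : N ^ p = I := starNorm_rpow _ hp
  refine (lintegral_rpow_le_of_le_add measure_star_univ_ne_zero (measure_star_univ_ne_top hw') hp
    (noncentered_le hw hw' hp hκ f)).trans ?_
  rw [starConst_mul hp0]
  refine mul_le_mul_right (add_le_add_right ?_ _) _
  refine (lintegral_tail_rpow _ _ hp).trans ?_
  rw [← hN, hNI]
  refine add_le_add le_rfl ?_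
  calc ∑ l, w l * (2 * N / w l) ^ p = 2 ^ p * (∑ l, w l * (w l)⁻¹ ^ p) * I := by
        rw [Finset.mul_sum, Finset.sum_mul]
        refine Finset.sum_congr rfl fun l _ => ?_
        rw [div_eq_mul_inv, ENNReal.mul_rpow_of_nonneg _ _ hp0, ENNReal.mul_rpow_of_nonneg _ _ hp0,
          hNI]
        ring
    _ ≤ _ := by gcongr

theorem noncentered_weakBound
    (hD : ∀ v : ℝ≥0∞, ∑ l, {l | w l < v}.indicator w l ≤ D * v ^ p) :
    WeakBound (starMeasure far w) (modifiedNoncenteredMaximal (starMeasure far w) κ) p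
      (starConst p D) := by
  intro f t ht
  have hp0 : 0 ≤ p := by linarith
  set I := ∫⁻ x, ‖f x‖ₑ ^ p ∂(starMeasure far w) with hI
  set N := starNorm (fun x => ‖f x‖ₑ) w p with hN
  have hNI : N ^ p = I := starNorm_rpow _ hp
  set τ : ℝ≥0∞ := t / 2 with hτ
  have hτ0 : τ ≠ 0 := ENNReal.div_ne_zero.2 ⟨by simpa using ht.ne', by simp⟩
  have hτT : τ ≠ ∞ := ENNReal.div_ne_top ENNReal.coe_ne_top (by simp)
  have ht2 : (t : ℝ≥0∞) = 2 * τ := (ENNReal.mul_div_cancel (by simp) (by simp)).symm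
  rw [ht2]
  refine (rpow_mul_measure_le_of_le_add measure_star_univ_ne_zero (measure_star_univ_ne_top hw') hp
    (noncentered_le hw hw' hp hκ f) τ).trans ?_
  rw [starConst_mul hp0]
  refine mul_le_mul_right (add_le_add_right ?_ _) _
  refine (rpow_mul_measure_lt_tail_le _ _ hp τ).trans ?_
  rw [← hN, hNI]
  refine add_le_add le_rfl ?_
  -- This turns the level set of the tail into a set of leaves of small weight, to which `hD`
  -- applies with `v = 2 * N / τ`.
  have hset : {l | τ < 2 * N / w l} = {l | w l < 2 * N / τ} := by
    ext l
    have hw0 : w l ≠ 0 := (zero_lt_one.trans_le (hw l)).ne'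
    simp only [mem_ofPred_eq]
    rw [ENNReal.lt_div_iff_mul_lt (Or.inl hw0) (Or.inl (hw' l)),
      ENNReal.lt_div_iff_mul_lt (Or.inl hτ0) (Or.inl hτT), mul_comm]
  rw [hset]
  calc τ ^ p * ∑ l, {l | w l < 2 * N / τ}.indicator w l
      ≤ τ ^ p * (D * (2 * N / τ) ^ p) := mul_le_mul_right (hD _) _
    _ = D * (τ * (2 * N / τ)) ^ p := by
        rw [ENNReal.mul_rpow_of_nonneg _ _ hp0]
        ring
    _ ≤ D * (2 * N) ^ p :=
        mul_le_mul_right (ENNReal.rpow_le_rpow ENNReal.mul_div_le hp0) _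
    _ = 2 ^ p * D * I := by
        rw [ENNReal.mul_rpow_of_nonneg _ _ hp0, hNI]
        ring

end Upper

/-- The mass `m` of a middle point satisfies `m ≤ 1 ≤ w l`, so `(m / w l) ^ p ≤ m / w l`: the
contribution of each leaf is at most that of its middle point to the norm of `f`, whatever the
number and weights of the leaves. -/
theorem centered_strongBound_of_near {L : Type} [Fintype L] {w : L → ℝ≥0∞}
    (hw : ∀ l, 1 ≤ w l) (hw' : ∀ l, w l ≠ ∞) {p κ : ℝ} (hp : 1 ≤ p) (hκ : 1 ≤ κ) :
    StrongBound (starMeasure false w) (modifiedCenteredMaximal (starMeasure false w) κ) p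
      (starConst p 1) := by
  intro f
  have hp0 : 0 ≤ p := by linarith
  set I := ∫⁻ x, ‖f x‖ₑ ^ p ∂(starMeasure false w) with hI
  set N := starNorm (fun x => ‖f x‖ₑ) w p with hN
  have hNI : N ^ p = I := starNorm_rpow _ hp
  refine (lintegral_rpow_le_of_le_add measure_star_univ_ne_zero (measure_star_univ_ne_top hw') hp
    (centered_le_of_near hw hw' hp hκ f)).trans ?_
  rw [starConst_mul hp0]
  refine mul_le_mul_right (add_le_add_right ?_ _) _
  refine (lintegral_tail_rpow _ _ hp).trans ?_
  rw [← hN, hNI]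
  refine add_le_add le_rfl ?_
  calc ∑ l, w l * (‖f (mid l)‖ₑ * (Fintype.card L : ℝ≥0∞)⁻¹ / w l) ^ p
      ≤ ∑ l, (Fintype.card L : ℝ≥0∞)⁻¹ * ‖f (mid l)‖ₑ ^ p := by
        refine Finset.sum_le_sum fun l _ => ?_
        set m : ℝ≥0∞ := (Fintype.card L : ℝ≥0∞)⁻¹ with hm
        have hm1 : m ≤ 1 := by
          rw [hm, ENNReal.inv_le_one]
          exact_mod_cast Fintype.card_pos_iff.2 ⟨l⟩
        have hmw : m / w l ≤ 1 := ENNReal.div_le_of_le_mul (by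
          rw [one_mul]
          exact hm1.trans (hw l))
        have hw0 : w l ≠ 0 := (zero_lt_one.trans_le (hw l)).ne'
        rw [mul_div_assoc, ENNReal.mul_rpow_of_nonneg _ _ hp0]
        calc w l * (‖f (mid l)‖ₑ ^ p * (m / w l) ^ p)
            ≤ w l * (‖f (mid l)‖ₑ ^ p * (m / w l)) := by
              gcongr
              exact ENNReal.rpow_le_self_of_le_one hmw hp
          _ = (m / w l * w l) * ‖f (mid l)‖ₑ ^ p := by ring
          _ = m * ‖f (mid l)‖ₑ ^ p := by rw [ENNReal.div_mul_cancel hw0 (hw' l)]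
    _ ≤ I := by
        rw [hI, lintegral_star]
        exact le_add_self.trans le_self_add
    _ ≤ 2 ^ p * (1 : ℝ≥0) * I := by
        rw [ENNReal.coe_one, mul_one]
        exact le_mul_of_one_le_left (by positivity)
          (ENNReal.one_le_rpow (by norm_num) (by linarith))

/-! ### Lower bounds on stars by testing on the center -/

section Lower

variable {far : Bool} {L : Type} [Fintype L] {w : L → ℝ≥0∞}

/-- The characteristic function of the center. -/
noncomputable def bump (far : Bool) (L : Type) : StarPt far L → ℂ := indicator {center} 1

theorem lintegral_bump_rpow {p : ℝ} (hp : 0 < p) :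
    ∫⁻ x, ‖bump far L x‖ₑ ^ p ∂(starMeasure far w) = 1 := by
  rw [lintegral_star]
  simp [bump, hp]

theorem inv_le_ratio_bump (hw : ∀ l, 1 ≤ w l) {S T : Set (StarPt far L)} {l : L}
    (hc : center ∈ S) (hT : ∀ i, leaf i ∈ T → i = l) :
    (3 * w l)⁻¹ ≤ (∫⁻ x in S, ‖bump far L x‖ₑ ∂(starMeasure far w)) / starMeasure far w T := by
  rw [← one_div]
  refine ENNReal.div_le_div ?_ ?_
  · refine le_trans (le_of_eq ?_) (lintegral_mono_set (singleton_subset_iff.2 hc))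
    rw [lintegral_singleton, starMeasure, weightedMeasure_singleton, weight]
    simp [bump]
  · rw [← setLIntegral_one]
    refine (setLIntegral_le_of_unique_leaf _ hT).trans ?_
    rw [setLIntegral_one, mul_one]
    calc starMeasure far w (core far L) + w l ≤ 2 * w l + w l := by
          gcongr
          exact measure_core_le.trans (le_mul_of_one_le_right (by positivity) (hw l))
      _ = 3 * w l := by ring

/-- The radius `1 / κ` around a leaf exceeds `1 / 2`, the distance to the center, exactly when `κ <
2`; the dilated radius `1` does not reach another far leaf. -/
theorem inv_le_centered_bump {w : L → ℝ≥0∞} (hw : ∀ l, 1 ≤ w l) {κ : ℝ} (hκ : 1 ≤ κ) (hκ2 : κ < 2)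
    (l : L) :
    (3 * w l)⁻¹ ≤ modifiedCenteredMaximal (starMeasure true w) κ (bump true L) (leaf l) := by
  have hκ0 : 0 < κ := by linarith
  refine le_trans ?_ (le_centered _ _ (s := 1 / κ) (by positivity))
  refine inv_le_ratio_bump hw (center_mem_ball_leaf l ?_) fun i hi => ?_
  · exact one_div_lt_one_div_of_lt hκ0 hκ2
  · rw [mul_one_div_cancel hκ0.ne'] at hi
    by_contra h
    exact leaf_notMem_ball_leaf h hi

/-- The ball around the middle point `mid l` with radius `3 / 4 / κ` contains the center and `leaf
l`, both at distance `1 / 4`, exactly when `κ < 3`; its dilation has radius `3 / 4`, the distance to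
the other leaves. The distance between leaves plays no role. -/
theorem inv_le_noncentered_bump (hw : ∀ l, 1 ≤ w l) {κ : ℝ} (hκ : 1 ≤ κ) (hκ3 : κ < 3) (l : L) :
    (3 * w l)⁻¹ ≤ modifiedNoncenteredMaximal (starMeasure far w) κ (bump far L) (leaf l) := by
  have hκ0 : 0 < κ := by linarith
  have hs : 1 / 4 < 3 / 4 / κ := by
    rw [lt_div_iff₀ hκ0]
    linarith
  refine le_trans ?_ (le_noncentered _ (s := 3 / 4 / κ) (by positivity) (leaf_mem_ball_mid l hs))
  refine inv_le_ratio_bump hw (center_mem_ball_mid l hs) fun i hi => ?_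
  rw [mul_div_cancel₀ _ hκ0.ne'] at hi
  by_contra h
  exact leaf_notMem_ball_mid h hi

variable {H : (StarPt far L → ℂ) → StarPt far L → ℝ≥0∞} {p : ℝ} {C : ℝ≥0}

theorem sum_le_of_strongBound (hp : 0 < p) (hH : ∀ l, (3 * w l)⁻¹ ≤ H (bump far L) (leaf l))
    (h : StrongBound (starMeasure far w) H p C) : ∑ l, w l * (3 * w l)⁻¹ ^ p ≤ C := by
  have := h (bump far L)
  rw [lintegral_bump_rpow hp, mul_one, lintegral_star] at this
  refine le_trans (Finset.sum_le_sum fun l _ => ?_) (le_add_self.trans this)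
  exact mul_le_mul_right (ENNReal.rpow_le_rpow (hH l) hp.le) _

theorem sum_le_of_weakBound (hp : 0 < p) (hH : ∀ l, (3 * w l)⁻¹ ≤ H (bump far L) (leaf l))
    (h : WeakBound (starMeasure far w) H p C) {t : ℝ≥0} (ht : 0 < t) {s : Finset L}
    (hs : ∀ l ∈ s, t < (3 * w l)⁻¹) : (t : ℝ≥0∞) ^ p * ∑ l ∈ s, w l ≤ C := by
  have := h (bump far L) t ht
  rw [lintegral_bump_rpow hp, mul_one] at this
  refine le_trans (mul_le_mul_right ?_ _) this
  calc ∑ l ∈ s, w l = ∑ x ∈ s.map ⟨leaf, fun _ _ h => by injection h⟩, weight far w x := by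
        rw [Finset.sum_map]
        rfl
    _ = starMeasure far w (s.map ⟨leaf, fun _ _ h => by injection h⟩ : Finset (StarPt far L)) := by
        rw [← sum_measure_singleton]
        simp [starMeasure, weightedMeasure_singleton]
    _ ≤ _ := by
        refine measure_mono ?_
        intro x hx
        simp only [Finset.coe_map, mem_image] at hx
        obtain ⟨l, hl, rfl⟩ := hx
        exact (hs l hl).trans_le (hH l)

end Lower

end StarPt

/-- The family `B` of blocks satisfies uniform strong and weak type inequalities of the maximal
operators exactly for the exponents with the properties `Sc`, `Wc`, `S`, `W`. -/
def FamilyRealizes {ι : Type} (κ : ℝ) (B : ι → MetricBlock) (Sc Wc S W : ℝ → Prop) : Prop :=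
  ∀ p : ℝ, 1 ≤ p →
    ((∃ C : ℝ≥0, ∀ i, StrongBound (B i).measure ((B i).centered κ) p C) ↔ Sc p) ∧
    ((∃ C : ℝ≥0, ∀ i, WeakBound (B i).measure ((B i).centered κ) p C) ↔ Wc p) ∧
    ((∃ C : ℝ≥0, ∀ i, StrongBound (B i).measure ((B i).noncentered κ) p C) ↔ S p) ∧
    ((∃ C : ℝ≥0, ∀ i, WeakBound (B i).measure ((B i).noncentered κ) p C) ↔ W p)

/-- Stars with `m n j` leaves of weight `2 ^ j` for `j ≤ n` realize strong type exponents `S` and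
weak type exponents `W`. -/
def IsStarProfile (m : ℕ → ℕ → ℕ) (S W : ℝ → Prop) : Prop :=
  ∀ p : ℝ, 1 ≤ p →
    (S p ↔ ∃ D : ℝ, ∀ n, ∑ j ∈ Finset.range (n + 1), (m n j : ℝ) * 2 ^ ((1 - p) * j) ≤ D) ∧
    (W p → ∃ D : ℝ, ∀ n, ∀ J ≤ n,
      ∑ j ∈ Finset.range (J + 1), (m n j : ℝ) * 2 ^ (j : ℝ) ≤ D * 2 ^ (p * J)) ∧
    ((∃ D : ℝ, ∀ n, ∀ j ≤ n, (m n j : ℝ) * 2 ^ ((1 - p) * j) ≤ D) → W p)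

/-! ### Numbers of leaves that realize given pairs of rays -/

section Profiles

theorem two_rpow_mul_natCast (a : ℝ) (n : ℕ) : (2 : ℝ) ^ (a * n) = ((2 : ℝ) ^ a) ^ n := by
  rw [Real.rpow_mul (by norm_num), Real.rpow_natCast]

theorem le_zero_of_two_rpow_bounded {a D : ℝ} (h : ∀ n : ℕ, (2 : ℝ) ^ (a * n) ≤ D) : a ≤ 0 := by
  by_contra! ha
  have h1 : 1 < (2 : ℝ) ^ a := Real.one_lt_rpow (by norm_num) ha
  obtain ⟨n, hn⟩ := pow_unbounded_of_one_lt D h1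
  have := h n
  rw [two_rpow_mul_natCast] at this
  linarith

/-- With all leaves on one level the sum of the strong condition and the supremum of the weak one
are the same quantity, so the two ranges of exponents coincide. -/
theorem isStarProfile_single (M : ℕ → ℕ) (S : ℝ → Prop)
    (h : ∀ p, 1 ≤ p → (S p ↔ ∃ D : ℝ, ∀ n, (M n : ℝ) * 2 ^ ((1 - p) * n) ≤ D)) :
    IsStarProfile (fun n j => if j = n then M n else 0) S S := by
  intro p hp
  refine ⟨?_, ?_, ?_⟩
  · rw [h p hp]
    simp
  · rw [h p hp]
    rintro ⟨D, hD⟩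
    refine ⟨max D 0, fun n J hJ => ?_⟩
    rcases hJ.lt_or_eq with hlt | rfl
    · rw [Finset.sum_eq_zero]
      · positivity
      · intro j hj
        have : j ≠ n := by
          have := Finset.mem_range.1 hj
          omega
        simp [this]
    · have hs : ∑ j ∈ Finset.range (J + 1),
          ((if j = J then M J else 0 : ℕ) : ℝ) * 2 ^ (j : ℝ) = M J * 2 ^ (J : ℝ) := by simp
      rw [hs]
      calc (M J : ℝ) * 2 ^ (J : ℝ) = M J * 2 ^ ((1 - p) * J) * 2 ^ (p * J) := by
            rw [mul_assoc, ← Real.rpow_add (by norm_num)]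
            ring_nf
        _ ≤ _ := by
            gcongr
            exact (hD J).trans (le_max_left _ _)
  · rintro ⟨D, hD⟩
    rw [h p hp]
    exact ⟨D, fun n => by simpa using hD n n le_rfl⟩

theorem ceil_mul_le {a b : ℝ} (ha : 1 ≤ a) (hb : 0 ≤ b) : (⌈a⌉₊ : ℝ) * b ≤ 2 * (a * b) := by
  have := Nat.ceil_lt_add_one (by linarith : 0 ≤ a)
  nlinarith

theorem le_ceil_mul {a b : ℝ} (hb : 0 ≤ b) : a * b ≤ (⌈a⌉₊ : ℝ) * b :=
  mul_le_mul_of_nonneg_right (Nat.le_ceil a) hb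

theorem one_le_two_rpow_mul {p₀ : ℝ} (hp₀ : 1 ≤ p₀) (n : ℕ) : (1 : ℝ) ≤ 2 ^ ((p₀ - 1) * n) :=
  Real.one_le_rpow (by norm_num) (mul_nonneg (by linarith) n.cast_nonneg)

theorem two_rpow_mul_two_rpow (p₀ p : ℝ) (n : ℕ) :
    (2 : ℝ) ^ ((p₀ - 1) * n) * 2 ^ ((1 - p) * n) = 2 ^ ((p₀ - p) * n) := by
  rw [← Real.rpow_add (by norm_num)]
  ring_nf

theorem two_rpow_le_one {a : ℝ} (ha : a ≤ 0) (n : ℕ) : (2 : ℝ) ^ (a * n) ≤ 1 :=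
  Real.rpow_le_one_of_one_le_of_nonpos (by norm_num)
    (mul_nonpos_of_nonpos_of_nonneg ha n.cast_nonneg)

theorem isStarProfile_closed {p₀ : ℝ} (hp₀ : 1 ≤ p₀) :
    IsStarProfile (fun n j => if j = n then ⌈(2 : ℝ) ^ ((p₀ - 1) * n)⌉₊ else 0)
      (fun p => p₀ ≤ p) (fun p => p₀ ≤ p) := by
  refine isStarProfile_single (fun n => ⌈(2 : ℝ) ^ ((p₀ - 1) * n)⌉₊) _ fun p _ => ⟨fun h => ?_, ?_⟩
  · refine ⟨2, fun n => (ceil_mul_le (one_le_two_rpow_mul hp₀ n) (by positivity)).trans ?_⟩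
    rw [two_rpow_mul_two_rpow]
    linarith [two_rpow_le_one (sub_nonpos.2 h) n]
  · rintro ⟨D, hD⟩
    refine sub_nonpos.1 (le_zero_of_two_rpow_bounded (D := D) fun n => ?_)
    rw [← two_rpow_mul_two_rpow]
    exact (le_ceil_mul (by positivity)).trans (hD n)

/-- The polynomial factor `n + 1` destroys boundedness at `p = p₀` and is absorbed by geometric
decay for `p > p₀`. -/
theorem isStarProfile_open {p₀ : ℝ} (hp₀ : 1 ≤ p₀) :
    IsStarProfile (fun n j => if j = n then ⌈((n : ℝ) + 1) * (2 : ℝ) ^ ((p₀ - 1) * n)⌉₊ else 0)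
      (fun p => p₀ < p) (fun p => p₀ < p) := by
  refine isStarProfile_single (fun n => ⌈((n : ℝ) + 1) * (2 : ℝ) ^ ((p₀ - 1) * n)⌉₊) _
    fun p _ => ⟨fun h => ?_, ?_⟩
  · have hr : (2 : ℝ) ^ (p₀ - p) < 1 :=
      Real.rpow_lt_one_of_one_lt_of_neg (by norm_num) (sub_neg.2 h)
    obtain ⟨D, hD⟩ := (tendsto_self_mul_const_pow_of_lt_one (by positivity) hr).bddAbove_range
    refine ⟨2 * (D + 1), fun n => (ceil_mul_le ?_ (by positivity)).trans ?_⟩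
    · nlinarith [one_le_two_rpow_mul hp₀ n, (n.cast_nonneg : (0 : ℝ) ≤ n)]
    · rw [mul_assoc ((n : ℝ) + 1), two_rpow_mul_two_rpow, add_mul, one_mul]
      have h1 := hD ⟨n, rfl⟩
      have h2 := two_rpow_le_one (sub_neg.2 h).le n
      simp only [← two_rpow_mul_natCast] at h1
      linarith
  · rintro ⟨D, hD⟩
    by_contra! h
    obtain ⟨n, hn⟩ := exists_nat_gt D
    have h1 : ((n : ℝ) + 1) * (2 : ℝ) ^ ((p₀ - 1) * n) * 2 ^ ((1 - p) * n) ≤ D :=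
      (le_ceil_mul (by positivity)).trans (hD n)
    rw [mul_assoc, two_rpow_mul_two_rpow] at h1
    have h2 : (1 : ℝ) ≤ 2 ^ ((p₀ - p) * n) :=
      Real.one_le_rpow (by norm_num) (mul_nonneg (by linarith) n.cast_nonneg)
    nlinarith

theorem isStarProfile_top :
    IsStarProfile (fun n j => if j = n then 2 ^ (n * n) else 0)
      (fun _ => False) (fun _ => False) := by
  refine isStarProfile_single (fun n => 2 ^ (n * n)) _ fun p _ => ⟨False.elim, ?_⟩
  rintro ⟨D, hD⟩
  -- For `n > p` the exponent `(n + 1 - p) * n` is at least `n`, so the bound would give `2 ^ n ≤ D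
  -- < n`.
  obtain ⟨n, hn⟩ := exists_nat_gt (max D p)
  have h1 := hD n
  have h2 : ((2 ^ (n * n) : ℕ) : ℝ) * 2 ^ ((1 - p) * n) = 2 ^ ((n + 1 - p) * n) := by
    push_cast
    rw [← Real.rpow_natCast, ← Real.rpow_add (by norm_num)]
    push_cast
    ring_nf
  rw [h2] at h1
  have hp : p < n := (le_max_right _ _).trans_lt hn
  have hDn : D < n := (le_max_left _ _).trans_lt hn
  have h3 : (2 : ℝ) ^ (n : ℝ) ≤ 2 ^ ((n + 1 - p) * n) := by
    refine Real.rpow_le_rpow_of_exponent_le (by norm_num) ?_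
    nlinarith [(n.cast_nonneg : (0 : ℝ) ≤ n)]
  have h4 : (n : ℝ) < 2 ^ n := by exact_mod_cast Nat.lt_two_pow_self
  rw [Real.rpow_natCast] at h3
  linarith

theorem sum_range_pow_le_two_mul {r : ℝ} (hr : 2 ≤ r) (J : ℕ) :
    ∑ j ∈ Finset.range (J + 1), r ^ j ≤ 2 * r ^ J := by
  induction J with
  | zero => simp
  | succ J ih =>
    rw [Finset.sum_range_succ, pow_succ]
    nlinarith [pow_pos (by linarith : 0 < r) J]

/-- At `p = p₀` every level contributes a quantity between `1` and `2`: each level alone is bounded,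
their sum over `j ≤ n` is not. This separates weak from strong type. -/
theorem isStarProfile_mixed {p₀ : ℝ} (hp₀ : 1 ≤ p₀) :
    IsStarProfile (fun _ j => ⌈(2 : ℝ) ^ ((p₀ - 1) * j)⌉₊)
      (fun p => p₀ < p) (fun p => p₀ ≤ p) := by
  intro p hp
  refine ⟨⟨fun h => ?_, ?_⟩, fun h => ⟨4, fun n J _ => ?_⟩, ?_⟩
  · have hr : (2 : ℝ) ^ (p₀ - p) < 1 :=
      Real.rpow_lt_one_of_one_lt_of_neg (by norm_num) (sub_neg.2 h)
    refine ⟨∑' j : ℕ, 2 * ((2 : ℝ) ^ (p₀ - p)) ^ j, fun n => ?_⟩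
    refine le_trans (Finset.sum_le_sum fun j _ => ?_) (Summable.sum_le_tsum _
      (fun _ _ => by positivity) ((summable_geometric_of_lt_one (by positivity) hr).mul_left 2))
    refine (ceil_mul_le (one_le_two_rpow_mul hp₀ j) (by positivity)).trans (le_of_eq ?_)
    rw [two_rpow_mul_two_rpow, two_rpow_mul_natCast]
  · rintro ⟨D, hD⟩
    by_contra! h
    obtain ⟨n, hn⟩ := exists_nat_gt D
    have h1 : ∑ j ∈ Finset.range (n + 1), (1 : ℝ) ≤ D := by
      refine le_trans (Finset.sum_le_sum fun j _ => ?_) (hD n)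
      refine le_trans ?_ (le_ceil_mul (by positivity))
      rw [two_rpow_mul_two_rpow]
      exact Real.one_le_rpow (by norm_num) (mul_nonneg (by linarith) j.cast_nonneg)
    simp at h1
    linarith
  -- The sum is geometric with ratio `2 ^ p₀ ≥ 2`, hence comparable to its last term. One factor `2`
  -- in the constant `4` comes from the ceiling, the other one from this sum.
  · calc ∑ j ∈ Finset.range (J + 1), (⌈(2 : ℝ) ^ ((p₀ - 1) * j)⌉₊ : ℝ) * 2 ^ (j : ℝ)
        ≤ ∑ j ∈ Finset.range (J + 1), 2 * ((2 : ℝ) ^ p₀) ^ j := by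
          refine Finset.sum_le_sum fun j _ => ?_
          refine (ceil_mul_le (one_le_two_rpow_mul hp₀ j) (by positivity)).trans (le_of_eq ?_)
          rw [← Real.rpow_add (by norm_num), ← two_rpow_mul_natCast]
          ring_nf
      _ ≤ 4 * ((2 : ℝ) ^ p₀) ^ J := by
          rw [← Finset.mul_sum]
          have h2 : (2 : ℝ) ≤ 2 ^ p₀ := by
            simpa using Real.rpow_le_rpow_of_exponent_le (by norm_num : (1 : ℝ) ≤ 2) hp₀
          linarith [sum_range_pow_le_two_mul h2 J]
      _ ≤ 4 * 2 ^ (p * J) := by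
          rw [← two_rpow_mul_natCast]
          gcongr
          norm_num
  · rintro ⟨D, hD⟩
    refine sub_nonpos.1 (le_zero_of_two_rpow_bounded (D := D) fun n => ?_)
    rw [← two_rpow_mul_two_rpow]
    exact (le_ceil_mul (by positivity)).trans (hD n n le_rfl)

end Profiles

/-- A set of `m n j` leaves on each level `j ≤ n`. -/
abbrev Leaves (m : ℕ → ℕ → ℕ) (n : ℕ) : Type := Σ j : Fin (n + 1), Fin (m n j)

/-- The weight `2 ^ j` of the leaves of level `j`. -/
noncomputable def leafWeight (m : ℕ → ℕ → ℕ) (n : ℕ) (l : Leaves m n) : ℝ≥0∞ := 2 ^ (l.1 : ℕ)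

/-! ### Sums over the leaves in terms of the levels -/

section Leaves

variable {m : ℕ → ℕ → ℕ} {n : ℕ}

theorem one_le_leafWeight (l : Leaves m n) : 1 ≤ leafWeight m n l :=
  one_le_pow₀ (by norm_num)

theorem leafWeight_ne_top (l : Leaves m n) : leafWeight m n l ≠ ∞ :=
  ENNReal.pow_ne_top (by norm_num)

theorem sum_leaves (g : ℕ → ℝ≥0∞) :
    ∑ l : Leaves m n, g l.1 = ∑ j ∈ Finset.range (n + 1), m n j * g j := by
  rw [Fintype.sum_sigma, Finset.sum_range]
  simp

theorem two_pow_eq_ofReal (j : ℕ) : (2 : ℝ≥0∞) ^ j = ENNReal.ofReal (2 ^ (j : ℝ)) := by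
  rw [Real.rpow_natCast, ENNReal.ofReal_pow (by norm_num), ENNReal.ofReal_ofNat]

theorem two_pow_mul_inv_rpow (j : ℕ) (p : ℝ) :
    (2 : ℝ≥0∞) ^ j * ((2 : ℝ≥0∞) ^ j)⁻¹ ^ p = ENNReal.ofReal (2 ^ ((1 - p) * j)) := by
  rw [two_pow_eq_ofReal, ← ENNReal.ofReal_inv_of_pos (by positivity),
    ENNReal.ofReal_rpow_of_pos (by positivity), ← ENNReal.ofReal_mul (by positivity),
    ← Real.rpow_neg (by norm_num), ← Real.rpow_mul (by norm_num), ← Real.rpow_add (by norm_num)]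
  ring_nf

theorem sum_leafWeight_mul_inv_rpow (p : ℝ) :
    ∑ l : Leaves m n, leafWeight m n l * (leafWeight m n l)⁻¹ ^ p =
      ENNReal.ofReal (∑ j ∈ Finset.range (n + 1), (m n j : ℝ) * 2 ^ ((1 - p) * j)) := by
  refine (sum_leaves (fun j => 2 ^ j * ((2 : ℝ≥0∞) ^ j)⁻¹ ^ p)).trans ?_
  rw [ENNReal.ofReal_sum_of_nonneg fun j _ => by positivity]
  refine Finset.sum_congr rfl fun j _ => ?_
  rw [two_pow_mul_inv_rpow, ENNReal.ofReal_mul (by positivity), ENNReal.ofReal_natCast]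

theorem sum_leafWeight_lt_le {p D : ℝ} (hp : 0 ≤ p)
    (h : ∀ J ≤ n, ∑ j ∈ Finset.range (J + 1), (m n j : ℝ) * 2 ^ (j : ℝ) ≤ D * 2 ^ (p * J))
    (v : ℝ≥0∞) :
    ∑ l, {l | leafWeight m n l < v}.indicator (leafWeight m n) l ≤ D.toNNReal * v ^ p := by
  classical
  have h1 : ∑ l, {l | leafWeight m n l < v}.indicator (leafWeight m n) l
      = ∑ j ∈ (Finset.range (n + 1)).filter (fun j => (2 : ℝ≥0∞) ^ j < v),
          (m n j : ℝ≥0∞) * 2 ^ j := by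
    rw [Finset.sum_filter]
    refine Eq.trans ?_ ((sum_leaves (m := m) (n := n)
      (fun j => if (2 : ℝ≥0∞) ^ j < v then 2 ^ j else 0)).trans ?_)
    · refine Finset.sum_congr rfl fun l _ => ?_
      rw [indicator_apply]
      rfl
    · refine Finset.sum_congr rfl fun j _ => ?_
      split_ifs <;> simp
  rw [h1]
  set s := (Finset.range (n + 1)).filter (fun j => (2 : ℝ≥0∞) ^ j < v) with hs
  rcases s.eq_empty_or_nonempty with he | hne
  · simp [he]
  -- The highest level below `v` satisfies `2 ^ J < v`, so the hypothesis at the levels up to `J`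
  -- gives the bound in `v`.
  · set J := s.max' hne with hJ
    have hJs : J ∈ s := s.max'_mem hne
    rw [hs, Finset.mem_filter, Finset.mem_range] at hJs
    have hsub : s ⊆ Finset.range (J + 1) := fun j hj =>
      Finset.mem_range.2 (Nat.lt_succ_of_le (s.le_max' j hj))
    calc ∑ j ∈ s, (m n j : ℝ≥0∞) * 2 ^ j ≤ ∑ j ∈ Finset.range (J + 1), (m n j : ℝ≥0∞) * 2 ^ j :=
          Finset.sum_le_sum_of_subset hsub
      _ = ENNReal.ofReal (∑ j ∈ Finset.range (J + 1), (m n j : ℝ) * 2 ^ (j : ℝ)) := by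
          rw [ENNReal.ofReal_sum_of_nonneg fun j _ => by positivity]
          refine Finset.sum_congr rfl fun j _ => ?_
          rw [two_pow_eq_ofReal, ENNReal.ofReal_mul (by positivity), ENNReal.ofReal_natCast]
      _ ≤ ENNReal.ofReal (D * 2 ^ (p * J)) := ENNReal.ofReal_le_ofReal (h J (by omega))
      _ = D.toNNReal * ((2 : ℝ≥0∞) ^ J) ^ p := by
          rw [ENNReal.ofReal_mul' (by positivity), two_pow_eq_ofReal,
            ENNReal.ofReal_rpow_of_pos (by positivity), ← Real.rpow_mul (by norm_num), mul_comm p]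
          rfl
      _ ≤ _ := by
          refine mul_le_mul_right (ENNReal.rpow_le_rpow hJs.2.le hp) _

end Leaves

/-- The star with `m n j` leaves of weight `2 ^ j` for `j ≤ n`. -/
noncomputable def starBlock (far : Bool) (m : ℕ → ℕ → ℕ) (n : ℕ) : MetricBlock where
  carrier := StarPt far (Leaves m n)
  weight := StarPt.weight far (leafWeight m n)
  weight_ne_zero := StarPt.weight_ne_zero one_le_leafWeight
  weight_ne_top := StarPt.weight_ne_top leafWeight_ne_top
  dist_le_one := StarPt.dist_le_one

/-! ### Exponents realized by families of stars -/

section StarFamilies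

open StarPt

variable {m : ℕ → ℕ → ℕ} {S W : ℝ → Prop} {far : Bool} {κ p : ℝ}

theorem IsStarProfile.exists_noncentered_strongBound (hm : IsStarProfile m S W) (hp : 1 ≤ p)
    (hκ : 1 ≤ κ) (h : S p) :
    ∃ C : ℝ≥0, ∀ n, StrongBound (starMeasure far (leafWeight m n))
      (modifiedNoncenteredMaximal (starMeasure far (leafWeight m n)) κ) p C := by
  obtain ⟨D, hD⟩ := (hm p hp).1.1 h
  refine ⟨starConst p D.toNNReal, fun n => noncentered_strongBound one_le_leafWeight
    leafWeight_ne_top hp hκ ?_⟩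
  rw [sum_leafWeight_mul_inv_rpow]
  exact ENNReal.ofReal_le_ofReal (hD n)

theorem IsStarProfile.exists_noncentered_weakBound (hm : IsStarProfile m S W) (hp : 1 ≤ p)
    (hκ : 1 ≤ κ) (h : W p) :
    ∃ C : ℝ≥0, ∀ n, WeakBound (starMeasure far (leafWeight m n))
      (modifiedNoncenteredMaximal (starMeasure far (leafWeight m n)) κ) p C := by
  obtain ⟨D, hD⟩ := (hm p hp).2.1 h
  exact ⟨starConst p D.toNNReal, fun n => noncentered_weakBound one_le_leafWeight
    leafWeight_ne_top hp hκ (sum_leafWeight_lt_le (by linarith) (hD n))⟩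

theorem IsStarProfile.of_strongBound (hm : IsStarProfile m S W) (hp : 1 ≤ p)
    {H : ∀ n, (StarPt far (Leaves m n) → ℂ) → StarPt far (Leaves m n) → ℝ≥0∞}
    (hH : ∀ n l, (3 * leafWeight m n l)⁻¹ ≤ H n (bump far _) (leaf l))
    {C : ℝ≥0} (h : ∀ n, StrongBound (starMeasure far (leafWeight m n)) (H n) p C) : S p := by
  have hp0 : 0 < p := by linarith
  refine (hm p hp).1.2 ⟨((3 : ℝ≥0∞) ^ p * C).toReal, fun n => ?_⟩
  rw [← ENNReal.ofReal_le_iff_le_toReal (ENNReal.mul_ne_top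
    (ENNReal.rpow_ne_top_of_nonneg hp0.le (by norm_num)) ENNReal.coe_ne_top),
    ← sum_leafWeight_mul_inv_rpow]
  have h1 := sum_le_of_strongBound hp0 (hH n) (h n)
  refine le_trans (le_of_eq ?_) (mul_le_mul_right h1 _)
  rw [Finset.mul_sum]
  refine Finset.sum_congr rfl fun l _ => ?_
  have h3 : (3 : ℝ≥0∞) ^ p * 3⁻¹ ^ p = 1 := by
    rw [← ENNReal.mul_rpow_of_nonneg _ _ hp0.le,
      ENNReal.mul_inv_cancel (by norm_num) (by norm_num), ENNReal.one_rpow]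
  rw [ENNReal.mul_inv (by simp) (by simp), ENNReal.mul_rpow_of_nonneg _ _ hp0.le]
  calc leafWeight m n l * (leafWeight m n l)⁻¹ ^ p
      = (3 ^ p * 3⁻¹ ^ p) * (leafWeight m n l * (leafWeight m n l)⁻¹ ^ p) := by rw [h3, one_mul]
    _ = _ := by ring

/-- Testing at a height just below the values on level `j` isolates the mass of that level alone,
which is all the profile asks for. -/
theorem IsStarProfile.of_weakBound (hm : IsStarProfile m S W) (hp : 1 ≤ p)
    {H : ∀ n, (StarPt far (Leaves m n) → ℂ) → StarPt far (Leaves m n) → ℝ≥0∞}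
    (hH : ∀ n l, (3 * leafWeight m n l)⁻¹ ≤ H n (bump far _) (leaf l))
    {C : ℝ≥0} (h : ∀ n, WeakBound (starMeasure far (leafWeight m n)) (H n) p C) : W p := by
  classical
  have hp0 : 0 < p := by linarith
  refine (hm p hp).2.2 ⟨4 ^ p * C, fun n j hj => ?_⟩
  -- The factor `4` instead of `3` makes the inequality with the value `(3 * 2 ^ j)⁻¹` strict.
  set t : ℝ≥0 := (4 * 2 ^ j)⁻¹ with ht
  have hcoe : (t : ℝ≥0∞) = (4 * 2 ^ j)⁻¹ := by
    rw [ht, ENNReal.coe_inv (by positivity)]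
    push_cast
    rfl
  have h1 := sum_le_of_weakBound hp0 (hH n) (h n) (t := t) (by positivity)
    (s := Finset.univ.filter fun l => (l.1 : ℕ) = j) fun l hl => by
      rw [Finset.mem_filter] at hl
      rw [hcoe, leafWeight, hl.2, ENNReal.inv_lt_inv]
      exact ENNReal.mul_lt_mul_left (by positivity) (ENNReal.pow_ne_top (by norm_num))
        (by norm_num)
  have h2 : ∑ l ∈ Finset.univ.filter (fun l : Leaves m n => (l.1 : ℕ) = j), leafWeight m n l
      = m n j * 2 ^ j := by
    rw [Finset.sum_filter]
    refine (sum_leaves (m := m) (n := n) (fun i => if i = j then 2 ^ i else 0)).trans ?_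
    rw [Finset.sum_eq_single j]
    · simp
    · intro i _ hi
      simp [hi]
    · intro hj'
      exact absurd (Finset.mem_range.2 (Nat.lt_succ_of_le hj)) hj'
  rw [h2] at h1
  have h3 : ((t ^ p * (m n j * 2 ^ j) : ℝ≥0) : ℝ≥0∞) ≤ C := by
    rw [ENNReal.coe_mul, ENNReal.coe_rpow_of_nonneg _ hp0.le]
    exact_mod_cast h1
  have h4 : (t : ℝ) ^ p * (m n j * 2 ^ j) ≤ C := by exact_mod_cast ENNReal.coe_le_coe.1 h3
  have h5 : (t : ℝ) = 4⁻¹ * 2 ^ (-(j : ℝ)) := by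
    rw [ht, Real.rpow_neg (by norm_num), Real.rpow_natCast]
    push_cast
    rw [mul_inv]
  rw [h5, Real.mul_rpow (by norm_num) (by positivity), ← Real.rpow_mul (by norm_num),
    Real.inv_rpow (by norm_num), mul_assoc, inv_mul_le_iff₀ (by positivity)] at h4
  refine le_trans (le_of_eq ?_) h4
  rw [← Real.rpow_natCast, mul_left_comm, ← Real.rpow_add (by norm_num)]
  ring_nf

theorem IsStarProfile.familyRealizes_of_lt_two (hm : IsStarProfile m S W) (hκ : 1 ≤ κ)
    (hκ2 : κ < 2) : FamilyRealizes κ (starBlock true m) S W S W := by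
  intro p hp
  have hlow : ∀ n l, (3 * leafWeight m n l)⁻¹ ≤
      modifiedCenteredMaximal (starMeasure true (leafWeight m n)) κ (bump true _) (leaf l) :=
    fun n l => inv_le_centered_bump one_le_leafWeight hκ hκ2 l
  have hlow' : ∀ n l, (3 * leafWeight m n l)⁻¹ ≤
      modifiedNoncenteredMaximal (starMeasure true (leafWeight m n)) κ (bump true _) (leaf l) :=
    fun n l => (hlow n l).trans (centered_le_noncentered _ _)
  refine ⟨⟨?_, fun h => ?_⟩, ⟨?_, fun h => ?_⟩, ⟨?_, fun h => ?_⟩, ⟨?_, fun h => ?_⟩⟩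
  · rintro ⟨C, hC⟩
    exact hm.of_strongBound hp hlow hC
  · obtain ⟨C, hC⟩ := hm.exists_noncentered_strongBound (far := true) hp hκ h
    exact ⟨C, fun n => (hC n).mono_op (by linarith) centered_le_noncentered⟩
  · rintro ⟨C, hC⟩
    exact hm.of_weakBound hp hlow hC
  · obtain ⟨C, hC⟩ := hm.exists_noncentered_weakBound (far := true) hp hκ h
    exact ⟨C, fun n => (hC n).mono_op centered_le_noncentered⟩
  · rintro ⟨C, hC⟩
    exact hm.of_strongBound hp hlow' hC
  · exact hm.exists_noncentered_strongBound (far := true) hp hκ h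
  · rintro ⟨C, hC⟩
    exact hm.of_weakBound hp hlow' hC
  · exact hm.exists_noncentered_weakBound (far := true) hp hκ h

theorem IsStarProfile.familyRealizes_of_lt_three (hm : IsStarProfile m S W) (hκ : 1 ≤ κ)
    (hκ3 : κ < 3) :
    FamilyRealizes κ (starBlock false m) (fun _ => True) (fun _ => True) S W := by
  intro p hp
  have hlow : ∀ n l, (3 * leafWeight m n l)⁻¹ ≤
      modifiedNoncenteredMaximal (starMeasure false (leafWeight m n)) κ (bump false _) (leaf l) :=
    fun n l => inv_le_noncentered_bump one_le_leafWeight hκ hκ3 l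
  have hc : ∀ n, StrongBound (starMeasure false (leafWeight m n))
      (modifiedCenteredMaximal (starMeasure false (leafWeight m n)) κ) p (starConst p 1) :=
    fun n => centered_strongBound_of_near one_le_leafWeight leafWeight_ne_top hp hκ
  refine ⟨iff_true_intro ⟨_, hc⟩, iff_true_intro ⟨_, fun n => (hc n).weakBound (by linarith)⟩,
    ⟨?_, fun h => ?_⟩, ⟨?_, fun h => ?_⟩⟩
  · rintro ⟨C, hC⟩
    exact hm.of_strongBound hp hlow hC
  · exact hm.exists_noncentered_strongBound (far := false) hp hκ h
  · rintro ⟨C, hC⟩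
    exact hm.of_weakBound hp hlow hC
  · exact hm.exists_noncentered_weakBound (far := false) hp hκ h

/-- Stars without leaves serve as the neutral family, on which every inequality holds. -/
theorem familyRealizes_true (hκ : 1 ≤ κ) :
    FamilyRealizes κ (starBlock false fun _ _ => 0) (fun _ => True) (fun _ => True)
      (fun _ => True) (fun _ => True) := by
  have hm : IsStarProfile (fun _ _ => 0) (fun _ => True) (fun _ => True) := fun p _ =>
    ⟨⟨fun _ => ⟨0, fun n => by simp⟩, fun _ => trivial⟩, fun _ => ⟨0, fun n J _ => by simp⟩,
      fun _ => trivial⟩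
  intro p hp
  obtain ⟨C, hC⟩ := hm.exists_noncentered_strongBound (far := false) hp hκ trivial
  have hC' : ∀ n, StrongBound (starMeasure false (leafWeight (fun _ _ => 0) n))
      (modifiedCenteredMaximal (starMeasure false (leafWeight (fun _ _ => 0) n)) κ) p C :=
    fun n => (hC n).mono_op (by linarith) centered_le_noncentered
  exact ⟨iff_true_intro ⟨C, hC'⟩, iff_true_intro ⟨C, fun n => (hC' n).weakBound (by linarith)⟩,
    iff_true_intro ⟨C, hC⟩, iff_true_intro ⟨C, fun n => (hC n).weakBound (by linarith)⟩⟩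

end StarFamilies

/-! ### Chain blocks -/

section Schur

theorem ENNReal.sum_comp_le_tsum {α : Type*} (s : Finset α) (g : α → ℕ) (hg : Set.InjOn g s)
    (f : ℕ → ℝ≥0∞) : ∑ x ∈ s, f (g x) ≤ ∑' n, f n := by
  classical
  rw [← Finset.sum_image hg]
  exact ENNReal.sum_le_tsum _

/-- Schur's test. -/
theorem ENNReal.schur_test {α : Type*} [Fintype α] (b : α → α → ℝ≥0∞) {D : ℝ≥0∞}
    (h1 : ∀ k, ∑ i, b k i ≤ D) (h2 : ∀ i, ∑ k, b k i ≤ D) (h : α → ℝ≥0∞) {p : ℝ} (hp : 1 ≤ p) :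
    ∑ k, (∑ i, b k i * h i) ^ p ≤ D ^ (p - 1) * D * ∑ i, h i ^ p := by
  have hp0 : 0 < p := by linarith
  calc ∑ k, (∑ i, b k i * h i) ^ p ≤ ∑ k, D ^ (p - 1) * ∑ i, b k i * h i ^ p := by
        refine Finset.sum_le_sum fun k _ => ?_
        refine (ENNReal.rpow_le_rpow
          (ENNReal.inner_le_weight_mul_Lp_of_nonneg _ hp (b k) h) hp0.le).trans ?_
        rw [ENNReal.mul_rpow_of_nonneg _ _ hp0.le, ← ENNReal.rpow_mul, ← ENNReal.rpow_mul,
          inv_mul_cancel₀ hp0.ne', ENNReal.rpow_one, sub_mul, one_mul, inv_mul_cancel₀ hp0.ne']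
        exact mul_le_mul_left (ENNReal.rpow_le_rpow (h1 k) (by linarith)) _
    _ = D ^ (p - 1) * ∑ i, (∑ k, b k i) * h i ^ p := by
        rw [← Finset.mul_sum, Finset.sum_comm]
        simp_rw [Finset.sum_mul]
    _ ≤ D ^ (p - 1) * ∑ i, D * h i ^ p := by
        gcongr with i
        exact h2 i
    _ = _ := by rw [← Finset.mul_sum, mul_assoc]

end Schur

/-- The points of a chain, which lie at the positions `A ^ j / A ^ N`, `j ≤ N`, of the line. -/
def ChainPt (_A : ℝ) (N : ℕ) : Type := Fin (N + 1)

namespace ChainPt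

variable {A : ℝ} {N : ℕ}

instance : Fintype (ChainPt A N) := inferInstanceAs (Fintype (Fin (N + 1)))

noncomputable instance : LinearOrder (ChainPt A N) := inferInstanceAs (LinearOrder (Fin (N + 1)))

instance : Nonempty (ChainPt A N) := inferInstanceAs (Nonempty (Fin (N + 1)))

instance : MeasurableSpace (ChainPt A N) := ⊤

/-- The index of a point. -/
def idx (j : ChainPt A N) : ℕ := Fin.val j

/-- The point with a given index. -/
def pt (j : ℕ) (hj : j ≤ N) : ChainPt A N := (⟨j, Nat.lt_succ_of_le hj⟩ : Fin (N + 1))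

theorem idx_pt {j : ℕ} (hj : j ≤ N) : (pt j hj : ChainPt A N).idx = j := rfl

theorem idx_le (j : ChainPt A N) : j.idx ≤ N := Nat.le_of_lt_succ (Fin.is_lt j)

theorem idx_injective : Function.Injective (idx : ChainPt A N → ℕ) := Fin.val_injective

theorem sum_idx (g : ℕ → ℝ≥0∞) : ∑ j : ChainPt A N, g j.idx = ∑ j ∈ Finset.range (N + 1), g j :=
  Fin.sum_univ_eq_sum_range g (N + 1)

section Metric

variable [hA : Fact (1 < A)]

noncomputable instance : MetricSpace (ChainPt A N) :=
  MetricSpace.induced (fun j => A ^ j.idx / A ^ N) (fun i j h => by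
    have hA0 : 0 < A := one_pos.trans hA.out
    have h' : A ^ i.idx = A ^ j.idx := by
      simpa [div_left_inj' (pow_pos hA0 N).ne'] using h
    exact idx_injective (pow_right_injective₀ hA0 hA.out.ne' h')) inferInstance

theorem dist_eq (i j : ChainPt A N) : dist i j = |A ^ i.idx - A ^ j.idx| / A ^ N := by
  have hA0 : 0 < A := one_pos.trans hA.out
  change |A ^ i.idx / A ^ N - A ^ j.idx / A ^ N| = _
  rw [← sub_div, abs_div, abs_of_pos (pow_pos hA0 N)]

theorem mem_ball_div {i j : ChainPt A N} {s : ℝ} :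
    i ∈ ball j (s / A ^ N) ↔ |A ^ i.idx - A ^ j.idx| < s := by
  have hA0 : 0 < A := one_pos.trans hA.out
  rw [mem_ball, dist_eq, div_lt_div_iff_of_pos_right (pow_pos hA0 N)]

theorem dist_le_one (i j : ChainPt A N) : dist i j ≤ 1 := by
  have hA0 : 0 < A := one_pos.trans hA.out
  rw [dist_eq, div_le_one (pow_pos hA0 N)]
  have h : ∀ k : ChainPt A N, A ^ k.idx ≤ A ^ N := fun k => pow_le_pow_right₀ hA.out.le k.idx_le
  have h' : ∀ k : ChainPt A N, 0 < A ^ k.idx := fun k => pow_pos hA0 _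
  exact abs_sub_le_iff.2 ⟨by linarith [h i, h' j], by linarith [h j, h' i]⟩

end Metric

/-- The ratio of the weights of consecutive points. -/
noncomputable def ratio (N : ℕ) : ℝ≥0∞ := (N + 2 : ℕ)

theorem two_le_ratio : 2 ≤ ratio N := by
  rw [ratio]
  exact_mod_cast (by omega : 2 ≤ N + 2)

theorem ratio_ne_zero : ratio N ≠ 0 := (two_pos.trans_le two_le_ratio).ne'

theorem ratio_ne_top : ratio N ≠ ∞ := ENNReal.natCast_ne_top _

/-- The weights of a chain. -/
noncomputable def weight (j : ChainPt A N) : ℝ≥0∞ := ratio N ^ j.idx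

theorem weight_ne_zero (j : ChainPt A N) : weight j ≠ 0 := pow_ne_zero _ ratio_ne_zero

theorem weight_ne_top (j : ChainPt A N) : weight j ≠ ∞ := ENNReal.pow_ne_top ratio_ne_top

/-- The measure on a chain. -/
noncomputable def chainMeasure (A : ℝ) (N : ℕ) : Measure (ChainPt A N) := weightedMeasure weight

theorem lintegral_chain (F : ChainPt A N → ℝ≥0∞) :
    ∫⁻ x, F x ∂(chainMeasure A N) = ∑ x, weight x * F x := by
  rw [chainMeasure, lintegral_weightedMeasure, tsum_fintype]

theorem weight_le_measure {S : Set (ChainPt A N)} {j : ChainPt A N} (hj : j ∈ S) :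
    weight j ≤ chainMeasure A N S := by
  rw [← weightedMeasure_singleton weight j]
  exact measure_mono (singleton_subset_iff.2 hj)

theorem sum_range_ratio_pow_le (k : ℕ) :
    ∑ j ∈ Finset.range (k + 1), ratio N ^ j ≤ 2 * ratio N ^ k := by
  induction k with
  | zero => simp
  | succ k ih =>
    rw [Finset.sum_range_succ, two_mul]
    refine add_le_add (ih.trans ?_) le_rfl
    rw [pow_succ']
    gcongr
    exact two_le_ratio

theorem measure_Iic_le (k : ChainPt A N) : chainMeasure A N (Iic k) ≤ 2 * weight k := by
  classical
  rw [chainMeasure, weightedMeasure_apply, tsum_fintype]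
  refine le_trans (le_of_eq ?_) (sum_range_ratio_pow_le (N := N) k.idx)
  have h : Finset.range (k.idx + 1) = (Finset.range (N + 1)).filter (· ≤ k.idx) := by
    ext i
    have := k.idx_le
    simp only [Finset.mem_range, Finset.mem_filter]
    omega
  rw [h, Finset.sum_filter, ← sum_idx (A := A) (fun j => if j ≤ k.idx then ratio N ^ j else 0)]
  refine Finset.sum_congr rfl fun j _ => ?_
  rw [indicator_apply]
  rfl

/-- The averages over initial segments of a chain. -/
noncomputable def average (F : ChainPt A N → ℝ≥0∞) (k : ChainPt A N) : ℝ≥0∞ :=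
  (∫⁻ x in Iic k, F x ∂(chainMeasure A N)) / weight k

/-- With `k` the largest point of the set, the set lies in `Iic k` and has mass at least that of
`k`. All balls are thus reduced to initial segments. -/
theorem ratio_le_average (F : ChainPt A N → ℝ≥0∞) {S : Set (ChainPt A N)} {u : ChainPt A N}
    (hu : u ∈ S) :
    ∃ k, u ≤ k ∧ (∫⁻ x in S, F x ∂(chainMeasure A N)) / chainMeasure A N S ≤ average F k := by
  obtain ⟨k, hk, hmax⟩ := exists_max_image S id S.toFinite ⟨u, hu⟩
  exact ⟨k, hmax u hu, ENNReal.div_le_div (lintegral_mono_set hmax) (weight_le_measure hk)⟩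

/-! ### Bounds for the noncentered operator on chains -/

section Noncentered

variable [Fact (1 < A)] {κ : ℝ} (hκ : 1 ≤ κ)

include hκ

theorem noncentered_le_average (f : ChainPt A N → ℂ) {u : ChainPt A N} {t : ℝ≥0∞}
    (ht : t < modifiedNoncenteredMaximal (chainMeasure A N) κ f u) :
    ∃ k, u ≤ k ∧ t < average (fun x => ‖f x‖ₑ) k := by
  simp only [modifiedNoncenteredMaximal, lt_iSup_iff] at ht
  obtain ⟨y, s, hs, hu, h⟩ := ht
  obtain ⟨k, hk, hk'⟩ := ratio_le_average (fun x => ‖f x‖ₑ) hu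
  exact ⟨k, hk, h.trans_le ((div_measure_le hκ y hs _).trans hk')⟩

/-- The level set lies in the initial segment up to the largest `J` whose average exceeds `t`, and
that segment has mass at most `2 * weight J`. No covering argument is needed. -/
theorem noncentered_weakBound_one :
    WeakBound (chainMeasure A N) (modifiedNoncenteredMaximal (chainMeasure A N) κ) 1 2 := by
  classical
  intro f t ht
  simp only [ENNReal.rpow_one]
  set F : ChainPt A N → ℝ≥0∞ := fun x => ‖f x‖ₑ with hF
  set s := Finset.univ.filter fun k => (t : ℝ≥0∞) < average F k with hs
  rcases s.eq_empty_or_nonempty with he | hne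
  · have : {x | (t : ℝ≥0∞) < modifiedNoncenteredMaximal (chainMeasure A N) κ f x} = ∅ := by
      refine eq_empty_of_forall_notMem fun x hx => ?_
      obtain ⟨k, -, hk⟩ := noncentered_le_average hκ f hx
      have : k ∈ s := Finset.mem_filter.2 ⟨Finset.mem_univ _, hk⟩
      simp [he] at this
    simp [this]
  · set J := s.max' hne with hJ
    have hJs : (t : ℝ≥0∞) < average F J := (Finset.mem_filter.1 (s.max'_mem hne)).2
    calc (t : ℝ≥0∞) * chainMeasure A N
          {x | (t : ℝ≥0∞) < modifiedNoncenteredMaximal (chainMeasure A N) κ f x}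
        ≤ average F J * (2 * weight J) := by
          refine mul_le_mul' hJs.le ((measure_mono fun x hx => ?_).trans (measure_Iic_le J))
          obtain ⟨k, hk, hk'⟩ := noncentered_le_average hκ f hx
          exact hk.trans (s.le_max' k (Finset.mem_filter.2 ⟨Finset.mem_univ _, hk'⟩))
      _ = 2 * ∫⁻ x in Iic J, F x ∂(chainMeasure A N) := by
          rw [mul_left_comm, average, ENNReal.div_mul_cancel (weight_ne_zero J) (weight_ne_top J)]
      _ ≤ _ := by
          rw [ENNReal.coe_ofNat]
          exact mul_le_mul_right (setLIntegral_le_lintegral _ _) _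

/-- Replacing the supremum over `k` by a sum is affordable because the averages are weighted by
masses that grow geometrically. -/
theorem noncentered_rpow_le (f : ChainPt A N → ℂ) (u : ChainPt A N) {p : ℝ} (hp : 0 < p) :
    modifiedNoncenteredMaximal (chainMeasure A N) κ f u ^ p ≤
      ∑ k, (Iic k).indicator (fun _ => average (fun x => ‖f x‖ₑ) k ^ p) u := by
  rw [← ENNReal.rpow_inv_rpow hp.ne' (∑ k, _)]
  refine ENNReal.rpow_le_rpow (le_of_forall_lt fun t ht => ?_) hp.le
  obtain ⟨k, hk, hk'⟩ := noncentered_le_average hκ f ht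
  refine hk'.trans_le ((ENNReal.le_rpow_inv_iff hp).2 ?_)
  have h1 : average (fun x => ‖f x‖ₑ) k ^ p =
      (Iic k).indicator (fun _ => average (fun x => ‖f x‖ₑ) k ^ p) u :=
    (indicator_of_mem (mem_Iic.2 hk) (fun _ => average (fun x => ‖f x‖ₑ) k ^ p)).symm
  rw [h1]
  exact Finset.single_le_sum
    (f := fun k => (Iic k).indicator (fun _ => average (fun x => ‖f x‖ₑ) k ^ p) u)
    (fun _ _ => by positivity) (Finset.mem_univ k)

omit hκ [Fact (1 < A)] in
-- A discrete Hardy inequality. For the normalized values `weight i ^ p⁻¹ * F i` the averaging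
-- matrix has entries `(weight k / weight i) ^ (p⁻¹ - 1)` for `i ≤ k`, at most `r ^ (k - i)` because
-- the ratio of the weights is at least `2`. Schur's test applies with the geometric sum `(1 -
-- r)⁻¹`, which is `∞` for `p = 1`.
theorem sum_weight_mul_average_rpow_le (F : ChainPt A N → ℝ≥0∞) {p : ℝ} (hp : 1 ≤ p) :
    ∑ k, weight k * average F k ^ p ≤
      ((1 - (2 ^ (1 - p⁻¹))⁻¹)⁻¹) ^ (p - 1) * (1 - (2 ^ (1 - p⁻¹))⁻¹)⁻¹ *
        ∫⁻ x, F x ^ p ∂(chainMeasure A N) := by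
  classical
  have hp0 : 0 < p := by linarith
  have hθ : 0 ≤ 1 - p⁻¹ := sub_nonneg.2 (inv_le_one_of_one_le₀ hp)
  set r : ℝ≥0∞ := (2 ^ (1 - p⁻¹))⁻¹ with hr
  set b : ChainPt A N → ChainPt A N → ℝ≥0∞ :=
    fun k i => if i ≤ k then r ^ (k.idx - i.idx) else 0 with hb
  have hle : ∀ i k : ChainPt A N, i ≤ k ↔ i.idx ≤ k.idx := fun _ _ => Iff.rfl
  have key := ENNReal.schur_test b (D := (1 - r)⁻¹) (fun k => ?_) (fun i => ?_)
    (fun i => weight i ^ p⁻¹ * F i) hp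
  · refine le_trans (Finset.sum_le_sum fun k _ => ?_) (key.trans (le_of_eq ?_))
    · have hk : weight k * average F k ^ p = (weight k ^ p⁻¹ * average F k) ^ p := by
        rw [ENNReal.mul_rpow_of_nonneg _ _ hp0.le, ← ENNReal.rpow_mul, inv_mul_cancel₀ hp0.ne',
          ENNReal.rpow_one]
      rw [hk]
      refine ENNReal.rpow_le_rpow ?_ hp0.le
      rw [average, ← lintegral_indicator MeasurableSet.of_discrete, lintegral_chain,
        div_eq_mul_inv, Finset.sum_mul, Finset.mul_sum]
      refine Finset.sum_le_sum fun i _ => ?_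
      by_cases hik : i ≤ k
      · simp only [hb, if_pos hik, indicator_of_mem (mem_Iic.2 hik)]
        have hx0 : ratio N ^ (k.idx - i.idx) ≠ 0 := pow_ne_zero _ ratio_ne_zero
        have hxT : ratio N ^ (k.idx - i.idx) ≠ ∞ := ENNReal.pow_ne_top ratio_ne_top
        have hwk : weight k = ratio N ^ (k.idx - i.idx) * weight i := by
          rw [weight, weight, ← pow_add, Nat.sub_add_cancel ((hle i k).1 hik)]
        set x := ratio N ^ (k.idx - i.idx) with hx
        have hxr : x ^ p⁻¹ * x⁻¹ ≤ r ^ (k.idx - i.idx) := by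
          have h1 : x ^ p⁻¹ * x⁻¹ = (x ^ (1 - p⁻¹))⁻¹ := by
            rw [← ENNReal.rpow_neg_one, ← ENNReal.rpow_add _ _ hx0 hxT, ← ENNReal.rpow_neg]
            ring_nf
          rw [h1, hr, ← ENNReal.inv_pow, ENNReal.inv_le_inv, ← ENNReal.rpow_natCast,
            ← ENNReal.rpow_mul, mul_comm, ENNReal.rpow_mul, ENNReal.rpow_natCast]
          refine ENNReal.rpow_le_rpow ?_ hθ
          rw [hx]
          gcongr
          exact two_le_ratio
        rw [hwk, ENNReal.mul_rpow_of_nonneg _ _ (by positivity),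
          ENNReal.mul_inv (Or.inl hx0) (Or.inl hxT)]
        calc x ^ p⁻¹ * weight i ^ p⁻¹ * (weight i * F i * (x⁻¹ * (weight i)⁻¹))
            = (x ^ p⁻¹ * x⁻¹) * (weight i * (weight i)⁻¹) * (weight i ^ p⁻¹ * F i) := by ring
          _ ≤ _ := by
            rw [ENNReal.mul_inv_cancel (weight_ne_zero i) (weight_ne_top i), mul_one]
            gcongr
      · simp [hb, hik]
    · congr 1
      rw [lintegral_chain]
      refine Finset.sum_congr rfl fun i _ => ?_
      rw [ENNReal.mul_rpow_of_nonneg _ _ hp0.le, ← ENNReal.rpow_mul, inv_mul_cancel₀ hp0.ne',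
        ENNReal.rpow_one]
  · rw [← Finset.sum_filter, ← ENNReal.tsum_geometric]
    refine ENNReal.sum_comp_le_tsum _ (fun i : ChainPt A N => k.idx - i.idx) ?_ (fun n => r ^ n)
    intro i hi j hj hij
    rw [Finset.mem_coe, Finset.mem_filter, hle] at hi hj
    refine idx_injective ?_
    simp only at hij
    omega
  · rw [← Finset.sum_filter, ← ENNReal.tsum_geometric]
    refine ENNReal.sum_comp_le_tsum _ (fun k : ChainPt A N => k.idx - i.idx) ?_ (fun n => r ^ n)
    intro k hk j hj hkj
    rw [Finset.mem_coe, Finset.mem_filter, hle] at hk hj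
    refine idx_injective ?_
    simp only at hkj
    omega

theorem exists_noncentered_strongBound {p : ℝ} (hp : 1 < p) :
    ∃ C : ℝ≥0, ∀ N, StrongBound (chainMeasure A N)
      (modifiedNoncenteredMaximal (chainMeasure A N) κ) p C := by
  have hp0 : 0 < p := by linarith
  set D : ℝ≥0∞ := (1 - (2 ^ (1 - p⁻¹))⁻¹)⁻¹ with hD
  -- Here `p > 1` enters: it makes the ratio of the geometric series less than `1`.
  have hDT : D ≠ ∞ := by
    rw [hD, ENNReal.inv_ne_top]
    refine (tsub_pos_of_lt (ENNReal.inv_lt_one.2 ?_)).ne'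
    exact ENNReal.one_lt_rpow (by norm_num) (sub_pos.2 (inv_lt_one_of_one_lt₀ hp))
  have hK : 2 * (D ^ (p - 1) * D) ≠ ∞ := ENNReal.mul_ne_top (by norm_num)
    (ENNReal.mul_ne_top (ENNReal.rpow_ne_top_of_nonneg (by linarith) hDT) hDT)
  refine ⟨(2 * (D ^ (p - 1) * D)).toNNReal, fun N f => ?_⟩
  rw [ENNReal.coe_toNNReal hK]
  calc ∫⁻ x, modifiedNoncenteredMaximal (chainMeasure A N) κ f x ^ p ∂(chainMeasure A N)
      ≤ ∫⁻ x, ∑ k, (Iic k).indicator (fun _ => average (fun x => ‖f x‖ₑ) k ^ p) x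
          ∂(chainMeasure A N) := lintegral_mono fun u => noncentered_rpow_le hκ f u hp0
    _ = ∑ k, average (fun x => ‖f x‖ₑ) k ^ p * chainMeasure A N (Iic k) := by
        rw [lintegral_finsetSum _ fun _ _ => Measurable.of_discrete]
        simp_rw [lintegral_indicator (MeasurableSet.of_discrete), setLIntegral_const]
    _ ≤ ∑ k, 2 * (weight k * average (fun x => ‖f x‖ₑ) k ^ p) := by
        refine Finset.sum_le_sum fun k _ => ?_
        calc _ ≤ average (fun x => ‖f x‖ₑ) k ^ p * (2 * weight k) :=
              mul_le_mul_right (measure_Iic_le k) _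
          _ = _ := by ring
    _ ≤ _ := by
        rw [← Finset.mul_sum, mul_assoc]
        exact mul_le_mul_right (sum_weight_mul_average_rpow_le _ hp.le) _

end Noncentered

end ChainPt

/-! ### Failure of strong type (1,1) on chains, and the centered bound -/

namespace ChainPt

variable {A : ℝ} {N : ℕ}

/-- The characteristic function of the first point. -/
noncomputable def bump (A : ℝ) (N : ℕ) : ChainPt A N → ℂ := indicator {pt 0 N.zero_le} 1

theorem lintegral_bump : ∫⁻ x, ‖bump A N x‖ₑ ∂(chainMeasure A N) = 1 := by
  classical
  rw [lintegral_chain, Finset.sum_eq_single (pt 0 N.zero_le)]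
  · simp [bump, weight, idx_pt]
  · intro j _ hj
    simp [bump, hj]
  · simp

theorem inv_le_ratio_bump {S T : Set (ChainPt A N)} {j : ChainPt A N}
    (h0 : pt 0 N.zero_le ∈ S) (hT : T ⊆ Iic j) :
    (2 * weight j)⁻¹ ≤
      (∫⁻ x in S, ‖bump A N x‖ₑ ∂(chainMeasure A N)) / chainMeasure A N T := by
  rw [← one_div]
  refine ENNReal.div_le_div ?_ ((measure_mono hT).trans (measure_Iic_le j))
  refine le_trans (le_of_eq ?_) (lintegral_mono_set (singleton_subset_iff.2 h0))
  rw [lintegral_singleton, chainMeasure, weightedMeasure_singleton]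
  simp [bump, weight, idx_pt]

/-- The value at `j` is at least `(2 * weight j)⁻¹`, so each of the `N` points after the first
contributes at least `1 / 2` to the integral, while the test function has norm `1`. -/
theorem not_strongBound_one {H : ∀ N, (ChainPt A N → ℂ) → ChainPt A N → ℝ≥0∞}
    (hH : ∀ N (j : ChainPt A N), 1 ≤ j.idx → (2 * weight j)⁻¹ ≤ H N (bump A N) j) :
    ¬ ∃ C : ℝ≥0, ∀ N, StrongBound (chainMeasure A N) (H N) 1 C := by
  rintro ⟨C, hC⟩
  obtain ⟨N, hN⟩ := exists_nat_gt (2 * C)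
  have h1 := hC N (bump A N)
  simp only [ENNReal.rpow_one] at h1
  rw [lintegral_bump, mul_one, lintegral_chain] at h1
  have h2 : (N : ℝ≥0∞) * 2⁻¹ ≤ C := by
    refine le_trans ?_ h1
    calc (N : ℝ≥0∞) * 2⁻¹ = ∑ j ∈ Finset.range (N + 1), if 1 ≤ j then (2⁻¹ : ℝ≥0∞) else 0 := by
          rw [Finset.sum_range_succ']
          simp
      _ = ∑ j : ChainPt A N, if 1 ≤ j.idx then (2⁻¹ : ℝ≥0∞) else 0 :=
          (sum_idx (A := A) (fun j => if 1 ≤ j then (2⁻¹ : ℝ≥0∞) else 0)).symm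
      _ ≤ _ := by
          refine Finset.sum_le_sum fun j _ => ?_
          split_ifs with hj
          · calc (2⁻¹ : ℝ≥0∞) = weight j * (2 * weight j)⁻¹ := by
                  rw [ENNReal.mul_inv (by simp) (by simp), mul_left_comm,
                    ENNReal.mul_inv_cancel (weight_ne_zero j) (weight_ne_top j), mul_one]
              _ ≤ _ := mul_le_mul_right (hH N j hj) _
          · exact zero_le
  rw [← div_eq_mul_inv, ENNReal.div_le_iff (by norm_num) (by norm_num), mul_comm] at h2
  have h3 : (N : ℝ≥0) ≤ 2 * C := by exact_mod_cast h2
  exact absurd hN (not_lt.2 h3)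

theorem inv_le_centered_bump {κ : ℝ} (hκ : 1 ≤ κ) [Fact (1 < 4 * κ)] (j : ChainPt (4 * κ) N) :
    (2 * weight j)⁻¹ ≤ modifiedCenteredMaximal (chainMeasure (4 * κ) N) κ (bump (4 * κ) N) j := by
  have hA0 : 0 < 4 * κ := by linarith
  have hj : 1 ≤ (4 * κ) ^ j.idx := one_le_pow₀ (by linarith)
  -- With `A = 4κ` the ball of radius `A ^ j` around the point `j` (before normalization) contains
  -- the first point, and the dilated radius `κ * A ^ j` is less than the gap `(4κ - 1) * A ^ j` to
  -- the next point.
  refine le_trans ?_ (le_centered _ _ (s := (4 * κ) ^ j.idx / (4 * κ) ^ N) (by positivity))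
  rw [← mul_div_assoc]
  refine inv_le_ratio_bump ?_ fun i hi => ?_
  · rw [mem_ball_div, idx_pt, pow_zero, abs_lt]
    constructor <;> linarith
  · rw [mem_ball_div] at hi
    by_contra h
    have hij : j.idx + 1 ≤ i.idx := Nat.lt_of_not_le h
    have h1 : (4 * κ) ^ (j.idx + 1) ≤ (4 * κ) ^ i.idx := pow_le_pow_right₀ (by linarith) hij
    rw [pow_succ] at h1
    have h2 := (le_abs_self _).trans_lt hi
    nlinarith

/-- The ball is centered at the predecessor of `j`, from where the first point and `j` are both
within reach although the dilated ball omits the successor of `j`. -/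
theorem inv_le_noncentered_bump {κ : ℝ} (hκ : 3 ≤ κ) [Fact (1 < κ)] (j : ChainPt κ N)
    (hj : 1 ≤ j.idx) :
    (2 * weight j)⁻¹ ≤ modifiedNoncenteredMaximal (chainMeasure κ N) κ (bump κ N) j := by
  have hκ0 : 0 < κ := by linarith
  obtain ⟨d, hd⟩ : ∃ d, j.idx = d + 1 := ⟨j.idx - 1, by omega⟩
  set y : ChainPt κ N := pt d (by have := j.idx_le; omega) with hy
  have hyd : y.idx = d := rfl
  set a := κ ^ d with ha
  have ha1 : 1 ≤ a := one_le_pow₀ (by linarith)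
  have haκ : a / κ ≤ a / 3 := by gcongr
  have haκ' : a / κ < a := div_lt_self (by linarith) (by linarith)
  -- This radius times `κ` is `κ ^ 2 * a - a`, exactly the distance from the predecessor to the
  -- successor of `j`; being open, the dilated ball just misses that point.
  have hs : 0 < κ * a - a / κ := by nlinarith
  have hjy : j ∈ ball y ((κ * a - a / κ) / κ ^ N) := by
    rw [mem_ball_div, hd, hyd, pow_succ, ← ha, abs_lt]
    constructor <;> nlinarith
  refine le_trans ?_ (le_noncentered _ (by positivity) hjy)
  rw [← mul_div_assoc]
  refine inv_le_ratio_bump ?_ fun i hi => ?_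
  · rw [mem_ball_div, idx_pt, hyd, pow_zero, abs_lt, ← ha]
    constructor <;> nlinarith
  · rw [mem_ball_div, hyd, ← ha] at hi
    by_contra h
    have hij : d + 2 ≤ i.idx := by
      have : j.idx < i.idx := Nat.lt_of_not_le h
      omega
    have h1 : κ ^ (d + 2) ≤ κ ^ i.idx := pow_le_pow_right₀ (by linarith) hij
    have h2 := (le_abs_self _).trans_lt hi
    have h3 : κ * (κ * a - a / κ) = κ ^ (d + 2) - a := by
      rw [ha]
      field_simp
      ring
    linarith

/-- The gaps to the left and to the right of a point have the ratio `κ`. Hence a ball that reaches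
any other point has a dilation that reaches the next point to the right. -/
theorem eq_singleton_or_succ_mem {κ : ℝ} [Fact (1 < κ)] (j : ChainPt κ N) {s : ℝ} (hs : 0 < s) :
    ball j s = {j} ∨ j.idx = N ∨
      ∃ h : j.idx + 1 ≤ N, pt (j.idx + 1) h ∈ ball j (κ * s) := by
  have hκ : 1 < κ := Fact.out
  by_cases h : ball j s = {j}
  · exact Or.inl h
  right
  rcases j.idx_le.eq_or_lt with hj | hj
  · exact Or.inl hj
  refine Or.inr ⟨hj, ?_⟩
  have hex : ∃ i ∈ ball j s, i ≠ j := by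
    by_contra! hcon
    exact h (Subset.antisymm (fun i hi => hcon i hi) (singleton_subset_iff.2 (mem_ball_self hs)))
  obtain ⟨i, hi, hij⟩ := hex
  have hN : 0 < κ ^ N := by positivity
  have hs' : s = s * κ ^ N / κ ^ N := (mul_div_cancel_right₀ s hN.ne').symm
  rw [hs', mem_ball_div] at hi
  rw [hs', ← mul_div_assoc, mem_ball_div, idx_pt]
  have hpos : 0 < s * κ ^ N := by positivity
  have hκj : κ ^ j.idx ≤ κ ^ (j.idx + 1) := pow_le_pow_right₀ hκ.le (Nat.le_succ _)
  rw [abs_of_nonneg (by linarith)]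
  rcases Nat.lt_or_gt_of_ne (fun h' => hij (idx_injective h')) with hlt | hgt
  · obtain ⟨d, hd⟩ : ∃ d, j.idx = d + 1 := ⟨j.idx - 1, by omega⟩
    have h1 : κ ^ i.idx ≤ κ ^ d := pow_le_pow_right₀ hκ.le (by omega)
    have h2 := (neg_le_abs _).trans_lt hi
    have h3 : κ ^ (j.idx + 1) - κ ^ j.idx = κ * (κ ^ j.idx - κ ^ d) := by
      rw [hd]
      ring
    rw [h3]
    gcongr
    linarith
  · have h1 : κ ^ (j.idx + 1) ≤ κ ^ i.idx := pow_le_pow_right₀ hκ.le hgt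
    have h2 := (le_abs_self _).trans_lt hi
    nlinarith

theorem centered_le {κ : ℝ} [Fact (1 < κ)] (f : ChainPt κ N → ℂ) (j : ChainPt κ N) :
    modifiedCenteredMaximal (chainMeasure κ N) κ f j ≤
      ‖f j‖ₑ + (∫⁻ x, ‖f x‖ₑ ∂(chainMeasure κ N)) * (ratio N ^ (j.idx + 1))⁻¹ +
        if j.idx = N then (∫⁻ x, ‖f x‖ₑ ∂(chainMeasure κ N)) * (weight j)⁻¹ else 0 := by
  have hκ : 1 < κ := Fact.out
  refine iSup₂_le fun s hs => ?_
  rcases eq_singleton_or_succ_mem j hs with h | h | ⟨h, hmem⟩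
  · refine (div_measure_le hκ.le j hs _).trans ?_
    rw [h, lintegral_singleton, add_assoc]
    exact (ENNReal.div_le_of_le_mul le_rfl).trans le_self_add
  · refine le_trans ?_ le_add_self
    rw [if_pos h, ← div_eq_mul_inv]
    exact ENNReal.div_le_div (setLIntegral_le_lintegral _ _)
      (weight_le_measure (mem_ball_self (by positivity)))
  · refine le_trans ?_ (le_add_self.trans le_self_add)
    rw [← div_eq_mul_inv]
    exact ENNReal.div_le_div (setLIntegral_le_lintegral _ _) (weight_le_measure hmem)

/-- Below the last point a ball with more than one element has the heavier successor in its
denominator. Each such term contributes at most `I / (N + 2)`, and there are `N + 1` points; this is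
why the ratio of weights grows with `N`. The constant `3` counts the function itself, these terms,
and the last point. -/
theorem centered_strongBound_one {κ : ℝ} [Fact (1 < κ)] :
    StrongBound (chainMeasure κ N) (modifiedCenteredMaximal (chainMeasure κ N) κ) 1 3 := by
  intro f
  simp only [ENNReal.rpow_one]
  set I := ∫⁻ x, ‖f x‖ₑ ∂(chainMeasure κ N) with hI
  refine (lintegral_mono fun j => centered_le f j).trans ?_
  rw [lintegral_add_right _ Measurable.of_discrete, lintegral_add_right _ Measurable.of_discrete,
    ← hI]
  have h1 : ∫⁻ j : ChainPt κ N, I * (ratio N ^ (j.idx + 1))⁻¹ ∂(chainMeasure κ N) ≤ I := by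
    rw [lintegral_chain]
    calc ∑ j : ChainPt κ N, weight j * (I * (ratio N ^ (j.idx + 1))⁻¹)
        = ∑ _j : ChainPt κ N, I * (ratio N)⁻¹ := by
          refine Finset.sum_congr rfl fun j _ => ?_
          rw [pow_succ, ENNReal.mul_inv (Or.inr ratio_ne_top) (Or.inr ratio_ne_zero)]
          calc _ = (weight j * (weight j)⁻¹) * (I * (ratio N)⁻¹) := by
                rw [weight]
                ring
            _ = _ := by rw [ENNReal.mul_inv_cancel (weight_ne_zero j) (weight_ne_top j), one_mul]
      _ = ((N + 1 : ℕ) : ℝ≥0∞) * (ratio N)⁻¹ * I := by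
          rw [Finset.sum_const, Finset.card_univ, nsmul_eq_mul,
            show Fintype.card (ChainPt κ N) = N + 1 from Fintype.card_fin _]
          ring
      _ ≤ ratio N * (ratio N)⁻¹ * I := by
          gcongr
          rw [ratio]
          exact_mod_cast Nat.le_succ _
      _ = I := by rw [ENNReal.mul_inv_cancel ratio_ne_zero ratio_ne_top, one_mul]
  have h2 : ∫⁻ j : ChainPt κ N, (if j.idx = N then I * (weight j)⁻¹ else 0)
      ∂(chainMeasure κ N) ≤ I := by
    rw [lintegral_chain, Finset.sum_eq_single (pt N le_rfl)]
    · rw [if_pos (idx_pt le_rfl), mul_left_comm, ENNReal.mul_inv_cancel (weight_ne_zero _) (weight_ne_top _),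
        mul_one]
    · intro j _ hj
      rw [if_neg, mul_zero]
      intro h
      exact hj (idx_injective h)
    · simp
  calc _ ≤ I + I + I := add_le_add (add_le_add le_rfl h1) h2
    _ = _ := by
      rw [ENNReal.coe_ofNat]
      ring

end ChainPt

/-- A chain as a block. -/
noncomputable def chainBlock (A : ℝ) [Fact (1 < A)] (N : ℕ) : MetricBlock where
  carrier := ChainPt A N
  weight := ChainPt.weight
  weight_ne_zero := ChainPt.weight_ne_zero
  weight_ne_top := ChainPt.weight_ne_top
  dist_le_one := ChainPt.dist_le_one

/-! ### Exponents realized by families of chains -/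

section ChainFamilies

open ChainPt

theorem familyRealizes_chain {κ : ℝ} (hκ : 1 ≤ κ) [Fact (1 < 4 * κ)] :
    FamilyRealizes κ (chainBlock (4 * κ)) (fun p => 1 < p) (fun _ => True) (fun p => 1 < p)
      (fun _ => True) := by
  intro p hp
  have hc : ¬ ∃ C : ℝ≥0, ∀ N, StrongBound (chainMeasure (4 * κ) N)
      (modifiedCenteredMaximal (chainMeasure (4 * κ) N) κ) 1 C :=
    not_strongBound_one fun N j _ => inv_le_centered_bump hκ j
  have hn : ¬ ∃ C : ℝ≥0, ∀ N, StrongBound (chainMeasure (4 * κ) N)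
      (modifiedNoncenteredMaximal (chainMeasure (4 * κ) N) κ) 1 C :=
    not_strongBound_one fun N j _ =>
      (inv_le_centered_bump hκ j).trans (centered_le_noncentered _ _)
  rcases hp.eq_or_lt with rfl | hp1
  · have hw : ∀ N, WeakBound (chainMeasure (4 * κ) N)
        (modifiedNoncenteredMaximal (chainMeasure (4 * κ) N) κ) 1 2 :=
      fun N => noncentered_weakBound_one hκ
    have hw' : ∀ N, WeakBound (chainMeasure (4 * κ) N)
        (modifiedCenteredMaximal (chainMeasure (4 * κ) N) κ) 1 2 :=
      fun N => (hw N).mono_op centered_le_noncentered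
    exact ⟨iff_of_false hc (lt_irrefl _), iff_true_intro ⟨2, hw'⟩, iff_of_false hn (lt_irrefl _),
      iff_true_intro ⟨2, hw⟩⟩
  · obtain ⟨C, hC⟩ := exists_noncentered_strongBound (A := 4 * κ) hκ hp1
    have hC' : ∀ N, StrongBound (chainMeasure (4 * κ) N)
        (modifiedCenteredMaximal (chainMeasure (4 * κ) N) κ) p C :=
      fun N => (hC N).mono_op (by linarith) centered_le_noncentered
    exact ⟨iff_of_true ⟨C, hC'⟩ hp1,
      iff_true_intro ⟨C, fun N => (hC' N).weakBound (by linarith)⟩, iff_of_true ⟨C, hC⟩ hp1,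
      iff_true_intro ⟨C, fun N => (hC N).weakBound (by linarith)⟩⟩

theorem familyRealizes_chain_of_three_le {κ : ℝ} (hκ : 3 ≤ κ) [Fact (1 < κ)] :
    FamilyRealizes κ (chainBlock κ) (fun _ => True) (fun _ => True) (fun p => 1 < p)
      (fun _ => True) := by
  intro p hp
  have hκ1 : 1 ≤ κ := by linarith
  have hn : ¬ ∃ C : ℝ≥0, ∀ N, StrongBound (chainMeasure κ N)
      (modifiedNoncenteredMaximal (chainMeasure κ N) κ) 1 C :=
    not_strongBound_one fun N j hj => inv_le_noncentered_bump hκ j hj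
  rcases hp.eq_or_lt with rfl | hp1
  · have hc : ∀ N, StrongBound (chainMeasure κ N)
        (modifiedCenteredMaximal (chainMeasure κ N) κ) 1 3 := fun N => centered_strongBound_one
    have hw : ∀ N, WeakBound (chainMeasure κ N)
        (modifiedNoncenteredMaximal (chainMeasure κ N) κ) 1 2 :=
      fun N => noncentered_weakBound_one hκ1
    exact ⟨iff_true_intro ⟨3, hc⟩, iff_true_intro ⟨3, fun N => (hc N).weakBound zero_le_one⟩,
      iff_of_false hn (lt_irrefl _), iff_true_intro ⟨2, hw⟩⟩
  · obtain ⟨C, hC⟩ := exists_noncentered_strongBound (A := κ) hκ1 hp1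
    have hC' : ∀ N, StrongBound (chainMeasure κ N)
        (modifiedCenteredMaximal (chainMeasure κ N) κ) p C :=
      fun N => (hC N).mono_op (by linarith) centered_le_noncentered
    exact ⟨iff_true_intro ⟨C, hC'⟩,
      iff_true_intro ⟨C, fun N => (hC' N).weakBound (by linarith)⟩, iff_of_true ⟨C, hC⟩ hp1,
      iff_true_intro ⟨C, fun N => (hC N).weakBound (by linarith)⟩⟩

end ChainFamilies

/-! ### Combining the families -/

theorem StrongBound.mono_const {X : Type*} [MeasurableSpace X] {μ : Measure X}
    {H : (X → ℂ) → X → ℝ≥0∞} {p : ℝ} {C C' : ℝ≥0} (hC : C ≤ C') (h : StrongBound μ H p C) :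
    StrongBound μ H p C' := fun f =>
  (h f).trans (mul_le_mul_left (ENNReal.coe_le_coe.2 hC) _)

theorem WeakBound.mono_const {X : Type*} [MeasurableSpace X] {μ : Measure X}
    {H : (X → ℂ) → X → ℝ≥0∞} {p : ℝ} {C C' : ℝ≥0} (hC : C ≤ C') (h : WeakBound μ H p C) :
    WeakBound μ H p C' := fun f t ht =>
  (h f t ht).trans (mul_le_mul_left (ENNReal.coe_le_coe.2 hC) _)

theorem exists_forall_sum_iff {ι ι' : Type} {P : ι ⊕ ι' → ℝ≥0 → Prop}
    (hP : ∀ i C C', C ≤ C' → P i C → P i C') :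
    (∃ C, ∀ i, P i C) ↔ (∃ C, ∀ i, P (Sum.inl i) C) ∧ ∃ C, ∀ i, P (Sum.inr i) C := by
  constructor
  · rintro ⟨C, hC⟩
    exact ⟨⟨C, fun i => hC _⟩, ⟨C, fun i => hC _⟩⟩
  · rintro ⟨⟨C, hC⟩, ⟨C', hC'⟩⟩
    refine ⟨max C C', ?_⟩
    rintro (i | i)
    · exact hP _ _ _ (le_max_left _ _) (hC i)
    · exact hP _ _ _ (le_max_right _ _) (hC' i)

theorem FamilyRealizes.sum {ι ι' : Type} {κ : ℝ} {B : ι → MetricBlock} {B' : ι' → MetricBlock}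
    {Sc Wc S W Sc' Wc' S' W' : ℝ → Prop} (h : FamilyRealizes κ B Sc Wc S W)
    (h' : FamilyRealizes κ B' Sc' Wc' S' W') :
    FamilyRealizes κ (Sum.elim B B') (fun p => Sc p ∧ Sc' p) (fun p => Wc p ∧ Wc' p)
      (fun p => S p ∧ S' p) (fun p => W p ∧ W' p) := by
  intro p hp
  obtain ⟨h1, h2, h3, h4⟩ := h p hp
  obtain ⟨h1', h2', h3', h4'⟩ := h' p hp
  refine ⟨?_, ?_, ?_, ?_⟩
  · exact (exists_forall_sum_iff (P := fun i C => StrongBound (Sum.elim B B' i).measure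
      ((Sum.elim B B' i).centered κ) p C) fun _ _ _ hC => StrongBound.mono_const hC).trans
      (and_congr h1 h1')
  · exact (exists_forall_sum_iff (P := fun i C => WeakBound (Sum.elim B B' i).measure
      ((Sum.elim B B' i).centered κ) p C) fun _ _ _ hC => WeakBound.mono_const hC).trans
      (and_congr h2 h2')
  · exact (exists_forall_sum_iff (P := fun i C => StrongBound (Sum.elim B B' i).measure
      ((Sum.elim B B' i).noncentered κ) p C) fun _ _ _ hC => StrongBound.mono_const hC).trans
      (and_congr h3 h3')
  · exact (exists_forall_sum_iff (P := fun i C => WeakBound (Sum.elim B B' i).measure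
      ((Sum.elim B B' i).noncentered κ) p C) fun _ _ _ hC => WeakBound.mono_const hC).trans
      (and_congr h4 h4')

theorem FamilyRealizes.congr {ι : Type} {κ : ℝ} {B : ι → MetricBlock}
    {Sc Wc S W Sc' Wc' S' W' : ℝ → Prop} (h : FamilyRealizes κ B Sc Wc S W)
    (h1 : ∀ p, 1 ≤ p → (Sc p ↔ Sc' p)) (h2 : ∀ p, 1 ≤ p → (Wc p ↔ Wc' p))
    (h3 : ∀ p, 1 ≤ p → (S p ↔ S' p)) (h4 : ∀ p, 1 ≤ p → (W p ↔ W' p)) :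
    FamilyRealizes κ B Sc' Wc' S' W' := fun p hp =>
  ⟨(h p hp).1.trans (h1 p hp), (h p hp).2.1.trans (h2 p hp), (h p hp).2.2.1.trans (h3 p hp),
    (h p hp).2.2.2.trans (h4 p hp)⟩

theorem IsStarProfile.congr {m : ℕ → ℕ → ℕ} {S W S' W' : ℝ → Prop} (h : IsStarProfile m S W)
    (h1 : ∀ p, 1 ≤ p → (S' p ↔ S p)) (h2 : ∀ p, 1 ≤ p → (W' p ↔ W p)) :
    IsStarProfile m S' W' := fun p hp =>
  ⟨(h1 p hp).trans (h p hp).1, fun hW => (h p hp).2.1 ((h2 p hp).1 hW),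
    fun hD => (h2 p hp).2 ((h p hp).2.2 hD)⟩

/-! ### Possible pairs of rays and the families realizing them -/

section Rays

variable {S W : Set ℝ≥0∞}

theorem IsExponentRay.top_mem (hS : IsExponentRay S) : ∞ ∈ S := by
  rcases hS with rfl | ⟨q, -, hq, rfl | rfl⟩
  · rfl
  · exact ⟨hq.le, le_rfl⟩
  · exact ⟨hq, le_rfl⟩

/-- Between a ray and its closure only the membership of the endpoint in `W` is undecided. -/
theorem IsExponentRay.pair_cases (hS : IsExponentRay S) (hSW : S ⊆ W) (hcl : W ⊆ closure S) :
    (∀ p : ℝ, 1 ≤ p → (ENNReal.ofReal p ∈ S ↔ False) ∧ (ENNReal.ofReal p ∈ W ↔ False)) ∨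
    ∃ p₀ : ℝ, 1 ≤ p₀ ∧
      ((∀ p : ℝ, 1 ≤ p → (ENNReal.ofReal p ∈ S ↔ p₀ ≤ p) ∧ (ENNReal.ofReal p ∈ W ↔ p₀ ≤ p)) ∨
      (∀ p : ℝ, 1 ≤ p → (ENNReal.ofReal p ∈ S ↔ p₀ < p) ∧ (ENNReal.ofReal p ∈ W ↔ p₀ ≤ p)) ∨
      (∀ p : ℝ, 1 ≤ p → (ENNReal.ofReal p ∈ S ↔ p₀ < p) ∧ (ENNReal.ofReal p ∈ W ↔ p₀ < p))) := by
  rcases hS with rfl | ⟨q, hq1, hqT, hS⟩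
  · left
    rw [closure_singleton] at hcl
    exact fun p _ => ⟨iff_false_intro ENNReal.ofReal_ne_top,
      iff_false_intro fun h => ENNReal.ofReal_ne_top (hcl h)⟩
  · right
    obtain ⟨p₀, hp₀, rfl⟩ : ∃ p₀ : ℝ, 1 ≤ p₀ ∧ q = ENNReal.ofReal p₀ :=
      ⟨q.toReal, by simpa using ENNReal.toReal_mono hqT.ne hq1, (ENNReal.ofReal_toReal hqT.ne).symm⟩
    have hle : ∀ p : ℝ, 1 ≤ p →
        (ENNReal.ofReal p ∈ Icc (ENNReal.ofReal p₀) ∞ ↔ p₀ ≤ p) := fun p hp => by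
      rw [mem_Icc, ENNReal.ofReal_le_ofReal_iff (by linarith), and_iff_left le_top]
    have hlt : ∀ p : ℝ, 1 ≤ p →
        (ENNReal.ofReal p ∈ Ioc (ENNReal.ofReal p₀) ∞ ↔ p₀ < p) := fun p hp => by
      rw [mem_Ioc, ENNReal.ofReal_lt_ofReal_iff (by linarith), and_iff_left le_top]
    refine ⟨p₀, hp₀, ?_⟩
    rcases hS with rfl | rfl
    · left
      rw [isClosed_Icc.closure_eq] at hcl
      rw [Subset.antisymm hcl hSW]
      exact fun p hp => ⟨hle p hp, hle p hp⟩
    · right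
      have hcl' : W ⊆ Icc (ENNReal.ofReal p₀) ∞ :=
        hcl.trans (closure_minimal Ioc_subset_Icc_self isClosed_Icc)
      by_cases hmem : ENNReal.ofReal p₀ ∈ W
      · left
        have hW : W = Icc (ENNReal.ofReal p₀) ∞ := by
          refine Subset.antisymm hcl' fun x hx => ?_
          rcases hx.1.eq_or_lt with h | h
          · rwa [← h]
          · exact hSW ⟨h, hx.2⟩
        rw [hW]
        exact fun p hp => ⟨hlt p hp, hle p hp⟩
      · right
        have hW : W = Ioc (ENNReal.ofReal p₀) ∞ := by
          refine Subset.antisymm (fun x hx => ⟨lt_of_le_of_ne (hcl' hx).1 ?_, le_top⟩) hSW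
          rintro rfl
          exact hmem hx
        rw [hW]
        exact fun p hp => ⟨hlt p hp, hlt p hp⟩

theorem IsExponentRay.exists_isStarProfile (hS : IsExponentRay S) (hSW : S ⊆ W)
    (hcl : W ⊆ closure S) :
    ∃ m, IsStarProfile m (fun p => ENNReal.ofReal p ∈ S) (fun p => ENNReal.ofReal p ∈ W) := by
  rcases hS.pair_cases hSW hcl with h | ⟨p₀, hp₀, h | h | h⟩
  · exact ⟨_, isStarProfile_top.congr (fun p hp => (h p hp).1) fun p hp => (h p hp).2⟩
  · exact ⟨_, (isStarProfile_closed hp₀).congr (fun p hp => (h p hp).1) fun p hp => (h p hp).2⟩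
  · exact ⟨_, (isStarProfile_mixed hp₀).congr (fun p hp => (h p hp).1) fun p hp => (h p hp).2⟩
  · exact ⟨_, (isStarProfile_open hp₀).congr (fun p hp => (h p hp).1) fun p hp => (h p hp).2⟩

/-- Once the weak range is everything, the closure condition leaves only strong type `(1, 1)` open:
exactly the choice between the neutral family and a chain. -/
theorem IsExponentRay.cases_of_weak_eq (hS : IsExponentRay S) (hSW : S ⊆ W) (hcl : W ⊆ closure S)
    (hW : W = Icc 1 ∞) :
    (∀ p : ℝ, 1 ≤ p → ENNReal.ofReal p ∈ W) ∧
      ((∀ p : ℝ, 1 ≤ p → ENNReal.ofReal p ∈ S) ∨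
        ∀ p : ℝ, 1 ≤ p → (ENNReal.ofReal p ∈ S ↔ 1 < p)) := by
  have hW' : ∀ p : ℝ, 1 ≤ p → ENNReal.ofReal p ∈ W := fun p hp => by
    rw [hW]
    exact ⟨by simpa using hp, le_top⟩
  refine ⟨hW', ?_⟩
  have h1 := hW' 1 le_rfl
  rcases hS.pair_cases hSW hcl with h | ⟨p₀, hp₀, h | h | h⟩
  · exact absurd h1 (h 1 le_rfl).2.1
  · have hp₀' : p₀ ≤ 1 := (h 1 le_rfl).2.1 h1
    exact Or.inl fun p hp => (h p hp).1.2 (hp₀'.trans hp)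
  · obtain rfl : p₀ = 1 := le_antisymm ((h 1 le_rfl).2.1 h1) hp₀
    exact Or.inr fun p hp => (h p hp).1
  · exact absurd ((h 1 le_rfl).2.1 h1) (not_lt.2 hp₀)

theorem exists_centered_family {κ : ℝ} (hκ : 1 ≤ κ) (hS : IsExponentRay S) (hSW : S ⊆ W)
    (hcl : W ⊆ closure S) (h2 : 2 ≤ κ → W = Icc 1 ∞) :
    ∃ B : ℕ → MetricBlock, FamilyRealizes κ B (fun p => ENNReal.ofReal p ∈ S)
      (fun p => ENNReal.ofReal p ∈ W) (fun p => ENNReal.ofReal p ∈ S)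
      (fun p => ENNReal.ofReal p ∈ W) := by
  rcases lt_or_ge κ 2 with hκ2 | hκ2
  · obtain ⟨m, hm⟩ := hS.exists_isStarProfile hSW hcl
    exact ⟨_, hm.familyRealizes_of_lt_two hκ hκ2⟩
  · obtain ⟨hW, h | h⟩ := hS.cases_of_weak_eq hSW hcl (h2 hκ2)
    · have hS' := fun p hp => (iff_true_intro (h p hp)).symm
      have hW' := fun p hp => (iff_true_intro (hW p hp)).symm
      exact ⟨_, (familyRealizes_true hκ).congr hS' hW' hS' hW'⟩
    · have : Fact (1 < 4 * κ) := ⟨by linarith⟩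
      have hS' := fun p hp => (h p hp).symm
      have hW' := fun p hp => (iff_true_intro (hW p hp)).symm
      exact ⟨_, (familyRealizes_chain hκ).congr hS' hW' hS' hW'⟩

theorem exists_noncentered_family {κ : ℝ} (hκ : 1 ≤ κ) (hS : IsExponentRay S) (hSW : S ⊆ W)
    (hcl : W ⊆ closure S) (h3 : 3 ≤ κ → W = Icc 1 ∞) :
    ∃ B : ℕ → MetricBlock, FamilyRealizes κ B (fun _ => True) (fun _ => True)
      (fun p => ENNReal.ofReal p ∈ S) (fun p => ENNReal.ofReal p ∈ W) := by
  rcases lt_or_ge κ 3 with hκ3 | hκ3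
  · obtain ⟨m, hm⟩ := hS.exists_isStarProfile hSW hcl
    exact ⟨_, hm.familyRealizes_of_lt_three hκ hκ3⟩
  · obtain ⟨hW, h | h⟩ := hS.cases_of_weak_eq hSW hcl (h3 hκ3)
    · exact ⟨_, (familyRealizes_true hκ).congr (fun _ _ => Iff.rfl) (fun _ _ => Iff.rfl)
        (fun p hp => (iff_true_intro (h p hp)).symm) fun p hp => (iff_true_intro (hW p hp)).symm⟩
    · have : Fact (1 < κ) := ⟨by linarith⟩
      exact ⟨_, (familyRealizes_chain_of_three_le hκ3).congr (fun _ _ => Iff.rfl)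
        (fun _ _ => Iff.rfl) (fun p hp => (h p hp).symm)
        fun p hp => (iff_true_intro (hW p hp)).symm⟩

end Rays

theorem theorem3p2p2 (κ : ℝ) (hκ : 1 ≤ κ) (Psc Pwc Ps Pw : Set ℝ≥0∞)
    -- the form of the four sets
    (hPsc : IsExponentRay Psc) (hPwc : IsExponentRay Pwc)
    (hPs : IsExponentRay Ps) (hPw : IsExponentRay Pw)
    -- the inclusions
    (h_s : Ps ⊆ Psc) (h_w : Pw ⊆ Pwc)
    (h_c : Psc ⊆ Pwc) (h_c' : Pwc ⊆ closure Psc)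
    (h_n : Ps ⊆ Pw) (h_n' : Pw ⊆ closure Ps)
    -- the weak type (1,1) constraints for large parameters
    (h2 : 2 ≤ κ → Pwc = Icc 1 ∞) (h3 : 3 ≤ κ → Pw = Icc 1 ∞) :
    ∃ (Z : Type) (_ : Nonempty Z) (_ : MetricSpace Z) (_ : MeasurableSpace Z) (_ : BorelSpace Z)
      (μ : Measure Z),
      (∀ (x : Z) (s : ℝ), 0 < s → 0 < μ (ball x s) ∧ μ (ball x s) < ∞) ∧
      ¬ IsDoublingMetricMeasure μ ∧
      ∀ p : ℝ≥0∞, 1 ≤ p →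
        (HasStrongTypePP μ (modifiedCenteredMaximal μ κ) p ↔ p ∈ Psc) ∧
        (HasWeakTypePP μ (modifiedCenteredMaximal μ κ) p ↔ p ∈ Pwc) ∧
        (HasStrongTypePP μ (modifiedNoncenteredMaximal μ κ) p ↔ p ∈ Ps) ∧
        (HasWeakTypePP μ (modifiedNoncenteredMaximal μ κ) p ↔ p ∈ Pw) := by
  -- The first family controls the centered operator and imposes the weaker restrictions `Psc`,
  -- `Pwc` on the noncentered one; the second family imposes the remaining restrictions without
  -- affecting the centered operator.
  obtain ⟨B, hB⟩ := exists_centered_family hκ hPsc h_c h_c' h2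
  obtain ⟨B', hB'⟩ := exists_noncentered_family hκ hPs h_n h_n' h3
  obtain ⟨Z, hZ, hmet, hmeas, hborel, μ, hball, hdoub, ⟨t1, t2, t3, t4⟩, hiff⟩ :=
    exists_nondoubling_glue hκ (Sum.elim B B')
  refine ⟨Z, hZ, hmet, hmeas, hborel, μ, hball, hdoub, fun p hp => ?_⟩
  by_cases hpT : p = ∞
  · subst hpT
    exact ⟨iff_of_true t1 hPsc.top_mem, iff_of_true t2 hPwc.top_mem, iff_of_true t3 hPs.top_mem,
      iff_of_true t4 hPw.top_mem⟩
  obtain ⟨q, hq, rfl⟩ : ∃ q : ℝ, 1 ≤ q ∧ p = ENNReal.ofReal q :=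
    ⟨p.toReal, by simpa using ENNReal.toReal_mono hpT hp, (ENNReal.ofReal_toReal hpT).symm⟩
  obtain ⟨i1, i2, i3, i4⟩ := hiff q hq
  obtain ⟨r1, r2, r3, r4⟩ := hB.sum hB' q hq
  exact ⟨i1.trans (r1.trans (and_iff_left trivial)), i2.trans (r2.trans (and_iff_left trivial)),
    i3.trans (r3.trans (and_iff_right_of_imp fun h => h_s h)),
    i4.trans (r4.trans (and_iff_right_of_imp fun h => h_w h))⟩
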